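/- Let $d\ge 1$ and let $F\in W^{1,\infty}(\mathbb{R}^d;\mathbb{R}^d)$ be a force field $F=F(x)$. Let $(f_\epsilon)$ be a family of real-valued functions on $\mathbb{R}^d_x\times\mathbb{R}^d_v$ that is bounded in $L^1_{loc}(dx\otimes dv)$, i.e. $\sup_\epsilon\int_K|f_\epsilon|\,dx\,dv<\infty$ for every compact $K\subset\mathbb{R}^d\times\mathbb{R}^d$. Assume that (a) $(f_\epsilon)$ is locally equiintegrable in $v$: for every $\eta>0$ and every compact $K\subset\mathbb{R}^d\times\mathbb{R}^d$ there is $\alpha>0$ such that for every (jointly measurable) family $(A_x)_{x\in\mathbb{R}^d}$ of measurable subsets of $\mathbb{R}^d$ with $\sup_{x}|A_x|<\alpha$ and every $\epsilon$, $$\int\Big(\int_{A_x}\mathbf 1_K(x,v)\,|f_\epsilon(x,v)|\,dv\Big)dx\le\eta;$$ (b) the distributions $v\cdot\nabla_x f_\epsilon+F\cdot\nabla_v f_\epsilon$ (where $F\cdot\nabla_v f_\epsilon=\operatorname{div}_v(F f_\epsilon)$) are functions forming a bounded family in $L^1_{loc}(dx\otimes dv)$. Then: 1. $(f_\epsilon)$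 is locally equiintegrable in $x$ and $v$: for every $\eta>0$ and every compact $K\subset\mathbb{R}^d\times\mathbb{R}^d$ there is $\alpha>0$ such that for every measurable $A\subset\mathbb{R}^d\times\mathbb{R}^d$ with $|A|<\alpha$ and every $\epsilon$, $\int_A\mathbf 1_K|f_\epsilon|\,dx\,dv\le\eta$. 2. For every $\Psi\in C^1_c(\mathbb{R}^d)$, the family $\rho_\epsilon(x)=\int f_\epsilon(x,v)\Psi(v)\,dv$ is relatively compact in $L^1_{loc}(\mathbb{R}^d,dx)$, i.e. it has compact closure in the topology of $L^1$-convergence on every compact set. -/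

import Mathlib

open MeasureTheory Set
open scoped ContDiff ENNReal

/-- The space `L¹_loc(X)`: classes modulo a.e. equality of locally integrable real functions. -/
def L1loc (X : Type*) [TopologicalSpace X] [MeasureSpace X] : Type _ :=
  {f : X →ₘ[(volume : Measure X)] ℝ // LocallyIntegrable f volume}

namespace L1loc

/-- Restriction `L¹_loc(X) → L¹(K)` to a compact set `K`. -/
noncomputable def restrict {X : Type*} [TopologicalSpace X] [MeasureSpace X]
    (K : TopologicalSpace.Compacts X) (f : L1loc X) :
    X →₁[(volume : Measure X).restrict (K : Set X)] ℝ :=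
  Integrable.toL1 (f.1 : X → ℝ) (f.2.integrableOn_isCompact K.isCompact)

/-- The usual (Fréchet) topology of `L¹_loc`: the coarsest one making every restriction to a compact
set continuous, that is, convergence in `L¹(K)` for every compact `K`. -/
noncomputable instance {X : Type*} [TopologicalSpace X] [MeasureSpace X] :
    TopologicalSpace (L1loc X) :=
  ⨅ K : TopologicalSpace.Compacts X, TopologicalSpace.induced (restrict K) inferInstance

end L1loc

/-- `F ∈ W^{1,∞}(ℝᵈ; ℝᵈ)`: `F` is in `L^∞` and has a weak (distributional) derivative in `L^∞`. -/
def MemW1Infty {d : ℕ} (F : EuclideanSpace ℝ (Fin d) → EuclideanSpace ℝ (Fin d)) : Prop :=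
  MemLp F ∞ volume ∧
  ∃ G : EuclideanSpace ℝ (Fin d) → EuclideanSpace ℝ (Fin d) →L[ℝ] EuclideanSpace ℝ (Fin d),
    MemLp G ∞ volume ∧
    ∀ φ : EuclideanSpace ℝ (Fin d) → ℝ, ContDiff ℝ ∞ φ → HasCompactSupport φ →
      ∀ w : EuclideanSpace ℝ (Fin d),
        ∫ x, (fderiv ℝ φ x w) • F x = - ∫ x, φ x • G x w

/-- The family `(f i)` is a bounded family of `L¹_loc(X)`. -/
def BoundedInL1loc {X ι : Type*} [TopologicalSpace X] [MeasureSpace X] (f : ι → X → ℝ) : Prop :=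
  (∀ i, LocallyIntegrable (f i) volume) ∧
  ∀ K : Set X, IsCompact K → ∃ C : ℝ, ∀ i, ∫ z in K, |f i z| ≤ C

/-- `v·∇ₓf + F(x)·∇ᵥf = g` in the sense of distributions on `ℝᵈ × ℝᵈ`, where points are written
`z = (x, v)`. As the field `(x, v) ↦ (v, F x)` is divergence free, moving it onto the test function
`φ` yields `-(v·∇ₓφ + F(x)·∇ᵥφ)`. -/
def IsTransportDeriv {d : ℕ} (F : EuclideanSpace ℝ (Fin d) → EuclideanSpace ℝ (Fin d))
    (f g : EuclideanSpace ℝ (Fin d) × EuclideanSpace ℝ (Fin d) → ℝ) : Prop :=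
  ∀ φ : EuclideanSpace ℝ (Fin d) × EuclideanSpace ℝ (Fin d) → ℝ,
    ContDiff ℝ ∞ φ → HasCompactSupport φ →
      ∫ z, f z * fderiv ℝ φ z (z.2, F z.1) = - ∫ z, g z * φ z

/-- Local equiintegrability in `x` and `v` of a family of functions on `ℝᵈ × ℝᵈ`. -/
def LocEquiintegrableXV {d : ℕ} {ι : Type*}
    (f : ι → EuclideanSpace ℝ (Fin d) × EuclideanSpace ℝ (Fin d) → ℝ) : Prop :=
  ∀ η : ℝ, 0 < η →
    ∀ K : Set (EuclideanSpace ℝ (Fin d) × EuclideanSpace ℝ (Fin d)), IsCompact K →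
      ∃ α : ℝ, 0 < α ∧
        ∀ A : Set (EuclideanSpace ℝ (Fin d) × EuclideanSpace ℝ (Fin d)), MeasurableSet A →
          volume A < ENNReal.ofReal α →
          ∀ i, ∫⁻ z in A, K.indicator (fun z => ‖f i z‖ₑ) z ≤ ENNReal.ofReal η

/-- Local equiintegrability in `v` of a family of functions on `ℝᵈ × ℝᵈ`. The families `(A x)` of
sets are those for which `{(x, v) | v ∈ A x}` is measurable, so that the iterated integral has a
measurable integrand. -/
def LocEquiintegrableV {d : ℕ} {ι : Type*}
    (f : ι → EuclideanSpace ℝ (Fin d) × EuclideanSpace ℝ (Fin d) → ℝ) : Prop :=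
  ∀ η : ℝ, 0 < η →
    ∀ K : Set (EuclideanSpace ℝ (Fin d) × EuclideanSpace ℝ (Fin d)), IsCompact K →
      ∃ α : ℝ, 0 < α ∧
        ∀ A : EuclideanSpace ℝ (Fin d) → Set (EuclideanSpace ℝ (Fin d)),
          MeasurableSet {z : EuclideanSpace ℝ (Fin d) × EuclideanSpace ℝ (Fin d) | z.2 ∈ A z.1} →
          (⨆ x, volume (A x)) < ENNReal.ofReal α →
          ∀ i, ∫⁻ x, ∫⁻ v in A x, K.indicator (fun z => ‖f i z‖ₑ) (x, v) ≤ ENNReal.ofReal η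

/-! ### Trajectories of Lipschitz fields and the measure-preserving kinetic flow. -/

section ODE

open scoped NNReal Topology

variable {E : Type*} [NormedAddCommGroup E] [NormedSpace ℝ E]

/-! After `F` is replaced by its Lipschitz representative, the field (v, F(x)) has a flow `Φ t` for
short times, and this flow preserves Lebesgue measure. Two facts about it carry everything. The
first is near-invariance: mollifying f and bounding the commutator with the transport operator
gives, for every localization u = χ f, the estimate ‖u ∘ Φ t − u‖₁ ≤ C|t| with C uniform over the
family (`IsKineticFlow.exists_lintegral_mul_comp_sub_le`). The second is dispersion: for fixed x and
t ≠ 0, the position at time t is an antilipschitz function of the initial velocity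
(`IsKineticFlow.norm_sub_le_norm_fst_sub`), so a small set of positions is reached from x only by a
small set of velocities.

Equiintegrability. Off a set B × ℝᵈ with |B| small, a small set of phase space has small v-sections,
and equiintegrability in v applies. The mass of u over B × ℝᵈ equals, up to C|t|, its mass over the
preimage of B × ℝᵈ under `Φ t`. By dispersion the v-sections of this preimage are small, so
equiintegrability in v applies again.

Compactness. It suffices that no sequence of averages is uniformly separated in L¹ of a compact set.
By equiintegrability u_n may be replaced by truncations bounded in L²; along a subsequence the
differences H_n of consecutive truncations tend weakly to 0. The L¹ distance of consecutive averages
is the integral of the corresponding difference of the u's against a sign φ_n(x). Near-invariance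
and measure preservation replace φ_n(x) by the mean of φ_n over the positions at N distinct small
times. Such means act compactly: if w_n tends weakly to 0, dispersion makes its values at two
distinct times decorrelate (`IsKineticFlow.tendsto_setIntegral_mul_comp_fst`), so the squared L²
norm of the mean is O(1/N) + o(1). Up to a small L² error, the mean of φ_n is then the mean of a
fixed weak limit, and its pairing with H_n is small. -/

/-- Two trajectories of a `K`-Lipschitz field diverge at most exponentially, in both directions of
time. -/
theorem LipschitzWith.dist_trajectories_le {b : E → E} {K : ℝ≥0} (hb : LipschitzWith K b) {R : ℝ}
    {γ₁ γ₂ : ℝ → E} (h₁ : ∀ t, |t| ≤ R → HasDerivAt γ₁ (b (γ₁ t)) t)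
    (h₂ : ∀ t, |t| ≤ R → HasDerivAt γ₂ (b (γ₂ t)) t) {t : ℝ} (ht : |t| ≤ R) :
    dist (γ₁ t) (γ₂ t) ≤ dist (γ₁ 0) (γ₂ 0) * Real.exp (K * |t|) := by
  have forward : ∀ {b : E → E}, LipschitzWith K b → ∀ {γ₁ γ₂ : ℝ → E},
      (∀ t, |t| ≤ R → HasDerivAt γ₁ (b (γ₁ t)) t) → (∀ t, |t| ≤ R → HasDerivAt γ₂ (b (γ₂ t)) t) →
      ∀ t, 0 ≤ t → t ≤ R →
      dist (γ₁ t) (γ₂ t) ≤ dist (γ₁ 0) (γ₂ 0) * Real.exp (K * t) := by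
    intro b hb γ₁ γ₂ h₁ h₂ t ht0 htR
    have key := dist_le_of_trajectories_ODE (v := fun _ => b) (f := γ₁) (g := γ₂) (a := 0) (b := t)
      (fun _ => hb)
      (fun s hs => (h₁ s (by rw [abs_of_nonneg hs.1]; exact hs.2.trans htR)).continuousAt.continuousWithinAt)
      (fun s hs => (h₁ s (by rw [abs_of_nonneg hs.1]; exact hs.2.le.trans htR)).hasDerivWithinAt)
      (fun s hs => (h₂ s (by rw [abs_of_nonneg hs.1]; exact hs.2.trans htR)).continuousAt.continuousWithinAt)
      (fun s hs => (h₂ s (by rw [abs_of_nonneg hs.1]; exact hs.2.le.trans htR)).hasDerivWithinAt)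
      le_rfl t ⟨ht0, le_rfl⟩
    simpa using key
  rcases le_total 0 t with h0 | h0
  · rw [abs_of_nonneg h0] at ht ⊢
    exact forward hb h₁ h₂ t h0 ht
  · rw [abs_of_nonpos h0] at ht ⊢
    have hrev : ∀ {γ : ℝ → E}, (∀ t, |t| ≤ R → HasDerivAt γ (b (γ t)) t) →
        ∀ t, |t| ≤ R → HasDerivAt (fun s => γ (-s)) (-b (γ (-t))) t := by
      intro γ h t ht
      simpa [Function.comp_def] using (h (-t) (by rwa [abs_neg])).scomp t (hasDerivAt_neg t)
    have := forward (b := fun z => - b z) hb.neg (hrev h₁) (hrev h₂) (-t) (by linarith) ht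
    simpa using this

/-- A globally Lipschitz field has integral curves on an interval whose length depends only on the
Lipschitz constant. -/
theorem LipschitzWith.exists_trajectory [CompleteSpace E] {b : E → E} {K : ℝ≥0}
    (hb : LipschitzWith K b) (hK : 0 < K) (z : E) :
    ∃ γ : ℝ → E, γ 0 = z ∧ ∀ t : ℝ, |t| ≤ 1 / (4 * K) → HasDerivAt γ (b (γ t)) t := by
  have hK' : (0 : ℝ) < K := hK
  set R : ℝ := 1 / (2 * K) with hR
  have hRpos : 0 < R := by positivity
  -- On the ball of radius ‖b z‖ / K around z the field is at most 2‖b z‖, so a trajectory needs at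
  -- least time 1 / (2K) to leave it. The factor ‖b z‖ cancels, which makes the time independent of
  -- z.
  set a : ℝ≥0 := ‖b z‖₊ / K with ha
  have hpl : IsPicardLindelof (fun _ => b) (tmin := -R) (tmax := R)
      ⟨0, by constructor <;> linarith⟩ z a 0 (2 * ‖b z‖₊) K := by
    refine ⟨fun _ _ => hb.lipschitzOnWith, fun _ _ => continuousOn_const, ?_, ?_⟩
    · intro _ _ x hx
      have h1 : ‖b x - b z‖ ≤ K * ‖x - z‖ := by
        simpa [dist_eq_norm] using hb.dist_le_mul x z
      have h2 : ‖x - z‖ ≤ ‖b z‖ / K := by simpa [dist_eq_norm, ha] using hx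
      have h3 : (K : ℝ) * ‖x - z‖ ≤ ‖b z‖ := by
        rw [le_div_iff₀ hK'] at h2; linarith
      have h4 := norm_le_norm_add_norm_sub (b z) (b x)
      rw [norm_sub_rev] at h4
      push_cast
      linarith
    · simp only [sub_zero, zero_sub, neg_neg, max_self, ha, hR]
      push_cast
      apply le_of_eq
      field_simp
      simp
  obtain ⟨γ, h0, hγ⟩ := hpl.exists_eq_forall_mem_Icc_hasDerivWithinAt₀
  refine ⟨γ, h0, fun t ht => ?_⟩
  have hlt : |t| < R := by
    refine ht.trans_lt ?_
    rw [hR, div_lt_div_iff₀ (by positivity) (by positivity)]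
    linarith
  rw [abs_lt] at hlt
  exact (hγ t ⟨hlt.1.le, hlt.2.le⟩).hasDerivAt (Icc_mem_nhds hlt.1 hlt.2)

/-- `Φ` is the flow, for times in `[-2T, 2T]`, of the field `(x, v) ↦ (v, F x)`, where `F` is
`K`-Lipschitz and bounded by `M`, and `T` is small compared to `K`. -/
structure IsKineticFlow (F : E → E) (K : ℝ≥0) (M T : ℝ) (Φ : ℝ → E × E → E × E) : Prop where
  lipschitz : LipschitzWith K F
  one_le : 1 ≤ K
  norm_le : ∀ x, ‖F x‖ ≤ M
  pos : 0 < T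
  mul_le : 8 * K * T ≤ 1
  zero : ∀ z, Φ 0 z = z
  hasDerivAt : ∀ z t, |t| ≤ 2 * T → HasDerivAt (fun s => Φ s z) ((Φ t z).2, F (Φ t z).1) t

theorem LipschitzWith.kineticField {E : Type*} [NormedAddCommGroup E] {F : E → E} {K : ℝ≥0}
    (hF : LipschitzWith K F) (hK : 1 ≤ K) :
    LipschitzWith K fun z : E × E => (z.2, F z.1) := by
  have h1 : LipschitzWith K fun z : E × E => z.2 := LipschitzWith.prod_snd.weaken hK
  have h2 : LipschitzWith K fun z : E × E => F z.1 := by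
    simpa [Function.comp_def] using hF.comp LipschitzWith.prod_fst
  simpa using h1.prodMk h2

theorem exists_isKineticFlow [CompleteSpace E] {F : E → E} {K : ℝ≥0} {M : ℝ}
    (hF : LipschitzWith K F) (hM : ∀ x, ‖F x‖ ≤ M) :
    ∃ (K' : ℝ≥0) (T : ℝ) (Φ : ℝ → E × E → E × E), IsKineticFlow F K' M T Φ := by
  have hF' : LipschitzWith (max K 1) F := hF.weaken (le_max_left _ _)
  have h1 : (1 : ℝ≥0) ≤ max K 1 := le_max_right _ _
  generalize max K 1 = K' at hF' h1
  have hpos : (0 : ℝ≥0) < K' := zero_lt_one.trans_le h1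
  have hpos' : (0 : ℝ) < K' := hpos
  choose γ h0 hγ using (hF'.kineticField h1).exists_trajectory hpos
  refine ⟨K', 1 / (8 * K'), fun t z => γ z t, hF', h1, hM, by positivity, ?_, h0, fun z t ht => ?_⟩
  · apply le_of_eq; field_simp
  · refine hγ z t (ht.trans (le_of_eq ?_))
    field_simp
    norm_num

instance {E : Type*} [NormedAddCommGroup E] [NormedSpace ℝ E] [FiniteDimensional ℝ E]
    [MeasureSpace E] [BorelSpace E] [(volume : Measure E).IsAddHaarMeasure] :
    (volume : Measure (E × E)).IsAddHaarMeasure :=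
  inferInstanceAs ((volume : Measure E).prod (volume : Measure E)).IsAddHaarMeasure

namespace IsKineticFlow

variable {F : E → E} {K : ℝ≥0} {M T : ℝ} {Φ : ℝ → E × E → E × E}

theorem bound_nonneg (h : IsKineticFlow F K M T Φ) : 0 ≤ M := (norm_nonneg _).trans (h.norm_le 0)

theorem mul_exp_le (h : IsKineticFlow F K M T Φ) {t : ℝ} (ht : |t| ≤ 2 * T) :
    Real.exp (K * |t|) ≤ 2 := by
  have h1 : (K : ℝ) * |t| ≤ 1 / 4 := by
    have := mul_le_mul_of_nonneg_left ht K.coe_nonneg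
    linarith [h.mul_le]
  have h2 := Real.exp_bound_div_one_sub_of_interval (x := 1 / 4) (by norm_num) (by norm_num)
  calc Real.exp (K * |t|) ≤ Real.exp (1 / 4) := Real.exp_le_exp.2 h1
    _ ≤ 2 := h2.trans (by norm_num)

theorem dist_le (h : IsKineticFlow F K M T Φ) {t : ℝ} (ht : |t| ≤ 2 * T) (z w : E × E) :
    dist (Φ t z) (Φ t w) ≤ 2 * dist z w := by
  have := (h.lipschitz.kineticField h.one_le).dist_trajectories_le (h.hasDerivAt z)
    (h.hasDerivAt w) ht
  simp only [h.zero] at this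
  refine this.trans ?_
  rw [mul_comm]
  exact mul_le_mul_of_nonneg_right (h.mul_exp_le ht) dist_nonneg

theorem lipschitzWith (h : IsKineticFlow F K M T Φ) {t : ℝ} (ht : |t| ≤ 2 * T) :
    LipschitzWith 2 (Φ t) :=
  LipschitzWith.of_dist_le_mul fun z w => h.dist_le ht z w

theorem continuous (h : IsKineticFlow F K M T Φ) {t : ℝ} (ht : |t| ≤ 2 * T) : Continuous (Φ t) :=
  (h.lipschitzWith ht).continuous

theorem abs_le_two_mul (h : IsKineticFlow F K M T Φ) {t : ℝ} (ht : |t| ≤ T) : |t| ≤ 2 * T := by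
  linarith [h.pos]

/-- Uniqueness of trajectories: as functions of s, both sides solve the equation with the same value
at s = 0. The sum s + t may reach 2T, which is why the flow is required on the doubled interval. -/
theorem comp (h : IsKineticFlow F K M T Φ) {s t : ℝ} (hs : |s| ≤ T) (ht : |t| ≤ T) (z : E × E) :
    Φ s (Φ t z) = Φ (s + t) z := by
  have := (h.lipschitz.kineticField h.one_le).dist_trajectories_le (R := T)
    (γ₁ := fun s => Φ s (Φ t z)) (γ₂ := fun s => Φ (s + t) z)
    (fun s hs => h.hasDerivAt _ s (h.abs_le_two_mul hs))
    (fun s hs => (h.hasDerivAt z (s + t)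
      ((abs_add_le s t).trans (by linarith))).comp_add_const s t) hs
  simpa [h.zero] using this

theorem neg_comp_self (h : IsKineticFlow F K M T Φ) {t : ℝ} (ht : |t| ≤ T) (z : E × E) :
    Φ (-t) (Φ t z) = z := by
  rw [h.comp (by rwa [abs_neg]) ht, neg_add_cancel, h.zero]

theorem comp_neg_self (h : IsKineticFlow F K M T Φ) {t : ℝ} (ht : |t| ≤ T) (z : E × E) :
    Φ t (Φ (-t) z) = z := by
  rw [h.comp ht (by rwa [abs_neg]), add_neg_cancel, h.zero]

theorem norm_sub_le_of_deriv_le {γ γ' : ℝ → E} {C t : ℝ}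
    (hγ : ∀ s, |s| ≤ |t| → HasDerivAt γ (γ' s) s) (hC : ∀ s, |s| ≤ |t| → ‖γ' s‖ ≤ C) :
    ‖γ t - γ 0‖ ≤ C * |t| := by
  have := Convex.norm_image_sub_le_of_norm_hasDerivWithin_le (𝕜 := ℝ) (f := γ) (f' := γ')
    (s := {s | |s| ≤ |t|}) (x := 0) (y := t) (C := C) (fun s hs => (hγ s hs).hasDerivWithinAt) hC
    (by
      have : {s : ℝ | |s| ≤ |t|} = Icc (-|t|) |t| := by ext s; simp [abs_le]
      rw [this]; exact convex_Icc _ _) (by simp) (by simp)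
  simpa using this

theorem hasDerivAt_fst (h : IsKineticFlow F K M T Φ) (z : E × E) {t : ℝ} (ht : |t| ≤ 2 * T) :
    HasDerivAt (fun s => (Φ s z).1) (Φ t z).2 t :=
  (h.hasDerivAt z t ht).fst

theorem hasDerivAt_snd (h : IsKineticFlow F K M T Φ) (z : E × E) {t : ℝ} (ht : |t| ≤ 2 * T) :
    HasDerivAt (fun s => (Φ s z).2) (F (Φ t z).1) t :=
  (h.hasDerivAt z t ht).snd

theorem norm_snd_sub_le (h : IsKineticFlow F K M T Φ) (z : E × E) {t : ℝ} (ht : |t| ≤ 2 * T) :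
    ‖(Φ t z).2 - z.2‖ ≤ M * |t| := by
  have := norm_sub_le_of_deriv_le (t := t) (fun s hs => h.hasDerivAt_snd z (hs.trans ht))
    (fun s _ => h.norm_le _)
  simpa [h.zero] using this

theorem norm_fst_sub_le (h : IsKineticFlow F K M T Φ) (z : E × E) {t : ℝ} (ht : |t| ≤ 2 * T) :
    ‖(Φ t z).1 - z.1‖ ≤ (‖z.2‖ + M * |t|) * |t| := by
  have := norm_sub_le_of_deriv_le (t := t) (C := ‖z.2‖ + M * |t|)
    (fun s hs => h.hasDerivAt_fst z (hs.trans ht))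
    (fun s hs => by
      have h1 := h.norm_snd_sub_le z (hs.trans ht)
      have h2 := norm_le_norm_add_norm_sub z.2 (Φ s z).2
      have h3 := mul_le_mul_of_nonneg_left hs h.bound_nonneg
      rw [norm_sub_rev] at h2
      linarith)
  simpa [h.zero] using this

/-- The position at time `t` depends on the initial velocity in an antilipschitz way. -/
theorem norm_sub_le_norm_fst_sub (h : IsKineticFlow F K M T Φ) {t : ℝ} (ht : |t| ≤ T) (x v w : E) :
    |t| / 2 * ‖v - w‖ ≤ ‖(Φ t (x, v)).1 - (Φ t (x, w)).1‖ := by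
  have htT := h.abs_le_two_mul ht
  have hz : dist (x, v) (x, w) = ‖v - w‖ := by simp [dist_eq_norm]
  have hfst : ∀ s, |s| ≤ |t| → ‖(Φ s (x, v)).1 - (Φ s (x, w)).1‖ ≤ 2 * ‖v - w‖ := by
    intro s hs
    have := h.dist_le (hs.trans htT) (x, v) (x, w)
    rw [hz, dist_eq_norm] at this
    exact (norm_fst_le (Φ s (x, v) - Φ s (x, w))).trans this
  -- The two forces differ by at most 2K‖v − w‖, and K|s| ≤ 1/8, so the difference of velocities
  -- stays within a quarter of ‖v − w‖ of its initial value v − w. Integrating once more, the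
  -- difference of positions stays close to t(v − w).
  have hsnd : ∀ s, |s| ≤ |t| →
      ‖(Φ s (x, v)).2 - (Φ s (x, w)).2 - (v - w)‖ ≤ 1 / 4 * ‖v - w‖ := by
    intro s hs
    have := norm_sub_le_of_deriv_le (t := s) (γ := fun s => (Φ s (x, v)).2 - (Φ s (x, w)).2)
      (C := 2 * K * ‖v - w‖)
      (fun r hr => (h.hasDerivAt_snd (x, v) ((hr.trans hs).trans htT)).sub
        (h.hasDerivAt_snd (x, w) ((hr.trans hs).trans htT)))
      (fun r hr => by
        have h1 := h.lipschitz.dist_le_mul (Φ r (x, v)).1 (Φ r (x, w)).1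
        rw [dist_eq_norm, dist_eq_norm] at h1
        have h2 := mul_le_mul_of_nonneg_left (hfst r (hr.trans hs)) K.coe_nonneg
        linarith)
    simp only [h.zero] at this
    refine this.trans ?_
    have h1 : (K : ℝ) * |s| ≤ 1 / 8 := by
      have := mul_le_mul_of_nonneg_left (hs.trans ht) K.coe_nonneg
      linarith [h.mul_le]
    nlinarith [norm_nonneg (v - w)]
  have := norm_sub_le_of_deriv_le (t := t)
    (γ := fun s => (Φ s (x, v)).1 - (Φ s (x, w)).1 - s • (v - w)) (C := 1 / 4 * ‖v - w‖)
    (fun s hs => ((h.hasDerivAt_fst (x, v) (hs.trans htT)).sub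
      (h.hasDerivAt_fst (x, w) (hs.trans htT))).sub ((hasDerivAt_id s).smul_const (v - w)))
    (fun s hs => by simpa using hsnd s hs)
  simp only [h.zero, sub_self, zero_smul, sub_zero] at this
  have h1 : ‖t • (v - w)‖ = |t| * ‖v - w‖ := by rw [norm_smul, Real.norm_eq_abs]
  have h2 := norm_sub_norm_le (t • (v - w)) (t • (v - w) - ((Φ t (x, v)).1 - (Φ t (x, w)).1))
  rw [sub_sub_cancel, norm_sub_rev (t • (v - w))] at h2
  have h3 : 0 ≤ |t| * ‖v - w‖ := by positivity
  nlinarith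

/-- The flow is continuous jointly in time and space. -/
theorem continuousOn_uncurry (h : IsKineticFlow F K M T Φ) :
    ContinuousOn (fun p : (E × E) × ℝ => Φ p.2 p.1) (univ ×ˢ {t | |t| ≤ 2 * T}) :=
  continuousOn_prod_of_continuousOn_lipschitzOnWith (fun p : (E × E) × ℝ => Φ p.2 p.1) 2
    (fun z _ t ht => (h.hasDerivAt z t ht).continuousAt.continuousWithinAt)
    (fun _ ht => (h.lipschitzWith ht).lipschitzOnWith)

/-- The flow over a short time `t` agrees up to `O(t²)` with the composition of two shears. -/
theorem dist_shear_le (h : IsKineticFlow F K M T Φ) (z : E × E) {t : ℝ} (ht : |t| ≤ T) :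
    dist (Φ t z) (z.1 + t • (z.2 + t • F z.1), z.2 + t • F z.1) ≤
      (K * (‖z.2‖ + M * T) + 2 * M) * |t| ^ 2 := by
  have htT := h.abs_le_two_mul ht
  have hM := h.bound_nonneg
  have hsnd : ‖(Φ t z).2 - (z.2 + t • F z.1)‖ ≤ K * (‖z.2‖ + M * T) * |t| ^ 2 := by
    have := norm_sub_le_of_deriv_le (t := t) (γ := fun s => (Φ s z).2 - s • F z.1)
      (C := K * ((‖z.2‖ + M * T) * |t|))
      (fun s hs => (h.hasDerivAt_snd z (hs.trans htT)).sub ((hasDerivAt_id s).smul_const _))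
      (fun s hs => by
        have h1 := h.lipschitz.dist_le_mul (Φ s z).1 z.1
        rw [dist_eq_norm, dist_eq_norm] at h1
        rw [one_smul]
        refine h1.trans (mul_le_mul_of_nonneg_left ?_ K.coe_nonneg)
        refine (h.norm_fst_sub_le z (hs.trans htT)).trans ?_
        have hT := h.pos
        gcongr
        exact hs.trans ht)
    simp only [h.zero, zero_smul, sub_zero] at this
    rw [show (Φ t z).2 - (z.2 + t • F z.1) = (Φ t z).2 - t • F z.1 - z.2 by abel]
    refine this.trans (le_of_eq (by ring))
  have hfst : ‖(Φ t z).1 - (z.1 + t • (z.2 + t • F z.1))‖ ≤ 2 * M * |t| ^ 2 := by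
    have := norm_sub_le_of_deriv_le (t := t) (γ := fun s => (Φ s z).1 - s • z.2)
      (C := M * |t|)
      (fun s hs => (h.hasDerivAt_fst z (hs.trans htT)).sub ((hasDerivAt_id s).smul_const _))
      (fun s hs => by
        rw [one_smul]
        exact (h.norm_snd_sub_le z (hs.trans htT)).trans
          (mul_le_mul_of_nonneg_left hs h.bound_nonneg))
    simp only [h.zero, zero_smul, sub_zero] at this
    have h2 : ‖t • t • F z.1‖ ≤ M * |t| ^ 2 := by
      rw [norm_smul, norm_smul, Real.norm_eq_abs]
      nlinarith [mul_le_mul_of_nonneg_left (h.norm_le z.1) (by positivity : 0 ≤ |t| ^ 2)]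
    rw [show (Φ t z).1 - (z.1 + t • (z.2 + t • F z.1)) =
      ((Φ t z).1 - t • z.2 - z.1) - t • t • F z.1 by rw [smul_add]; abel]
    refine (norm_sub_le _ _).trans ?_
    nlinarith
  rw [dist_eq_norm, Prod.norm_def]
  refine max_le (hfst.trans ?_) (hsnd.trans ?_) <;> gcongr
  · have : 0 ≤ K * (‖z.2‖ + M * T) := by have := h.pos; positivity
    linarith
  · linarith

variable [FiniteDimensional ℝ E] [MeasureSpace E] [BorelSpace E]
  [(volume : Measure E).IsAddHaarMeasure]

/-- The map is one step of the symplectic Euler scheme: first v is translated by tF(x) with x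
frozen, then x is translated by the new tv with v frozen. The second shear is obtained from a skew
product by conjugating with the swap. -/
theorem _root_.measurePreserving_shear {F : E → E} (hF : Continuous F) (t : ℝ) :
    MeasurePreserving (fun z : E × E => (z.1 + t • (z.2 + t • F z.1), z.2 + t • F z.1)) := by
  have h1 : MeasurePreserving (fun z : E × E => (z.1, z.2 + t • F z.1)) :=
    (MeasurePreserving.id (volume : Measure E)).skew_product
      (g := fun x v => v + t • F x) (by fun_prop)
      (Filter.Eventually.of_forall fun x =>
        (measurePreserving_add_right (volume : Measure E) (t • F x)).map_eq)
  have h2 : MeasurePreserving (fun z : E × E => (z.1, z.2 + t • z.1)) :=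
    (MeasurePreserving.id (volume : Measure E)).skew_product
      (g := fun x v => v + t • x) (by fun_prop)
      (Filter.Eventually.of_forall fun x =>
        (measurePreserving_add_right (volume : Measure E) (t • x)).map_eq)
  have h3 := Measure.measurePreserving_swap (μ := (volume : Measure E)) (ν := (volume : Measure E))
  exact ((h3.comp h2).comp h3).comp h1

/-- The measure of the preimage of a compact set under `Φ (k • t)`, for small `t`, is controlled by
comparison with the measure preserving shears. -/
theorem volume_preimage_cthickening_le (h : IsKineticFlow F K M T Φ) (S : Set (E × E)) {R C t : ℝ}
    (hR : Metric.cthickening 1 S ⊆ Metric.closedBall 0 R) (hC0 : 0 ≤ C)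
    (hC : K * (R + M * T + M * T) + 2 * M ≤ C) (k : ℕ) (hk : k * |t| ≤ T) (r : ℝ) (hr : 0 ≤ r)
    (hr1 : r + k * (2 * C * |t| ^ 2) ≤ 1) :
    volume (Φ (k * t) ⁻¹' Metric.cthickening r S) ≤
      volume (Metric.cthickening (r + k * (2 * C * |t| ^ 2)) S) := by
  induction k generalizing r with
  | zero => simp [show Φ 0 = id from funext h.zero]
  | succ k ih =>
    push_cast at hk hr1 ⊢
    have hk' : k * |t| ≤ T := by nlinarith [abs_nonneg t]
    have ht : |t| ≤ T := by nlinarith [abs_nonneg t, (Nat.cast_nonneg k : (0 : ℝ) ≤ k)]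
    have hkt : |(k : ℝ) * t| ≤ T := by rwa [abs_mul, Nat.abs_cast]
    have hkt' : |((k : ℝ) + 1) * t| ≤ T := by
      rwa [abs_mul, abs_of_nonneg (by positivity : (0 : ℝ) ≤ (k : ℝ) + 1)]
    -- The first of the k + 1 steps is replaced by the shear. Its local error C t² is at most
    -- doubled by the remaining flow, which is 2-Lipschitz; hence the increment 2 C t² of the
    -- thickening.
    have hsub : Φ ((k + 1) * t) ⁻¹' Metric.cthickening r S ⊆
        (fun z : E × E => (z.1 + t • (z.2 + t • F z.1), z.2 + t • F z.1)) ⁻¹'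
          (Φ (k * t) ⁻¹' Metric.cthickening (r + 2 * C * |t| ^ 2) S) := by
      intro z hz
      have hz1 : Φ ((k + 1) * t) z ∈ Metric.closedBall 0 R :=
        hR (Metric.cthickening_mono (by
          have : 0 ≤ ((k : ℝ) + 1) * (2 * C * |t| ^ 2) := by positivity
          linarith) _ hz)
      -- The local error depends on the initial velocity. It is bounded because the endpoint lies in
      -- the ball of radius R and the velocity moves by at most MT.
      have hz2 : ‖z.2‖ ≤ R + M * T := by
        have h1 := h.norm_snd_sub_le z (h.abs_le_two_mul hkt')
        have h2 : ‖(Φ ((k + 1) * t) z).2‖ ≤ R :=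
          (norm_snd_le _).trans (by simpa using hz1)
        have h3 := norm_le_norm_add_norm_sub (Φ ((k + 1) * t) z).2 z.2
        have h4 := mul_le_mul_of_nonneg_left hkt' h.bound_nonneg
        linarith
      have hd := h.dist_shear_le z ht
      have hd' : dist (Φ t z) (z.1 + t • (z.2 + t • F z.1), z.2 + t • F z.1) ≤ C * |t| ^ 2 := by
        refine hd.trans (mul_le_mul_of_nonneg_right (le_trans ?_ hC) (by positivity))
        gcongr
      have hd2 := h.dist_le (h.abs_le_two_mul hkt) (Φ t z)
        (z.1 + t • (z.2 + t • F z.1), z.2 + t • F z.1)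
      rw [h.comp hkt ht, show (k : ℝ) * t + t = (k + 1) * t by ring] at hd2
      have h5 : Φ (k * t) (z.1 + t • (z.2 + t • F z.1), z.2 + t • F z.1) ∈
          Metric.cthickening (2 * C * |t| ^ 2) (Metric.cthickening r S) :=
        Metric.mem_cthickening_of_dist_le _ _ _ _ hz (by rw [dist_comm]; linarith)
      have := Metric.cthickening_cthickening_subset (ε := 2 * C * |t| ^ 2) (by positivity) hr S h5
      rw [mem_preimage, mem_preimage, add_comm]
      exact this
    calc volume (Φ ((k + 1) * t) ⁻¹' Metric.cthickening r S) ≤ _ := measure_mono hsub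
      _ = volume (Φ (k * t) ⁻¹' Metric.cthickening (r + 2 * C * |t| ^ 2) S) :=
        (measurePreserving_shear h.lipschitz.continuous t).measure_preimage
          (((h.continuous (h.abs_le_two_mul hkt)).measurable
            Metric.isClosed_cthickening.measurableSet).nullMeasurableSet)
      _ ≤ _ := ih hk' _ (by positivity) (by linarith)
      _ = _ := by congr 2; ring

/-- Time t is cut into n steps. Each of them costs O(n⁻²) in thickening, hence O(n⁻¹) in total, and
the volume of a shrinking thickening of a compact set tends to the volume of the set. No derivative
of the flow is used, which suits a field that is only Lipschitz. -/
theorem volume_preimage_le_of_isCompact (h : IsKineticFlow F K M T Φ) {t : ℝ} (ht : |t| ≤ T)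
    {S : Set (E × E)} (hS : IsCompact S) : volume (Φ t ⁻¹' S) ≤ volume S := by
  obtain ⟨R, hR⟩ := (hS.cthickening (r := 1)).isBounded.subset_closedBall 0
  set C : ℝ := |K * (R + M * T + M * T) + 2 * M| with hC
  have hlim : Filter.Tendsto
      (fun n : ℕ => volume (Metric.cthickening (2 * C * |t| ^ 2 / n) S)) Filter.atTop
      (𝓝 (volume S)) :=
    (tendsto_measure_cthickening_of_isCompact hS).comp
      (tendsto_const_div_atTop_nhds_zero_nat _)
  have hev : ∀ᶠ n : ℕ in Filter.atTop, 2 * C * |t| ^ 2 / n ≤ 1 :=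
    (tendsto_const_div_atTop_nhds_zero_nat (2 * C * |t| ^ 2)).eventually_le_const one_pos
  refine ge_of_tendsto hlim ?_
  filter_upwards [hev, Filter.eventually_gt_atTop 0] with n hn hn0
  have hn0' : (0 : ℝ) < n := by exact_mod_cast hn0
  have heq : (n : ℝ) * (2 * C * |t / n| ^ 2) = 2 * C * |t| ^ 2 / n := by
    rw [abs_div, Nat.abs_cast]; field_simp
  have := h.volume_preimage_cthickening_le S (t := t / n) hR (abs_nonneg _) (le_abs_self _) n
    (by rw [abs_div, Nat.abs_cast]; field_simp; exact ht) 0 le_rfl (by rw [heq]; linarith)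
  rw [mul_div_cancel₀ _ hn0'.ne', heq, zero_add] at this
  exact (measure_mono (preimage_mono (Metric.self_subset_cthickening S))).trans this

/-- The inequality for t and for −t gives equality on compact sets. This also makes the pushforward
finite on compact sets, hence regular, so equality extends to open sets and then to all measurable
sets. -/
theorem measurePreserving (h : IsKineticFlow F K M T Φ) {t : ℝ} (ht : |t| ≤ T) :
    MeasurePreserving (Φ t) := by
  have hcont := h.continuous (h.abs_le_two_mul ht)
  have ht' : |-t| ≤ T := by rwa [abs_neg]
  have hcont' := h.continuous (h.abs_le_two_mul ht')
  refine ⟨hcont.measurable, ?_⟩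
  have himg : ∀ S : Set (E × E), Φ t ⁻¹' S = Φ (-t) '' S := fun S =>
    (congrFun (image_eq_preimage_of_inverse (h.comp_neg_self ht) (h.neg_comp_self ht)) S).symm
  have hcompact : ∀ S : Set (E × E), IsCompact S →
      (volume.map (Φ t)) S = (volume : Measure (E × E)) S := by
    intro S hS
    rw [Measure.map_apply hcont.measurable hS.measurableSet]
    refine le_antisymm (h.volume_preimage_le_of_isCompact ht hS) ?_
    have hc : IsCompact (Φ t ⁻¹' S) := by rw [himg]; exact hS.image hcont'
    have := h.volume_preimage_le_of_isCompact ht' hc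
    rwa [← preimage_comp, show Φ t ∘ Φ (-t) = id from funext (h.comp_neg_self ht),
      preimage_id] at this
  have : IsFiniteMeasureOnCompacts ((volume : Measure (E × E)).map (Φ t)) :=
    ⟨fun S hS => by rw [hcompact S hS]; exact hS.measure_lt_top⟩
  apply Measure.OuterRegular.ext_isOpen
  exact fun U hU => Measure.InnerRegularWRT.eq_of_innerRegularWRT_of_forall_eq
    Measure.Regular.innerRegular Measure.Regular.innerRegular hcompact hU

end IsKineticFlow

end ODE

/-! ### Mollification and Lipschitz representatives of bounded functions with bounded weak
derivative. -/

section Mollification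

open Filter
open scoped NNReal Topology

theorem fderiv_comp_sub_left {G : Type*} [NormedAddCommGroup G] [NormedSpace ℝ G] (ψ : G → ℝ)
    (z y w : G) :
    fderiv ℝ (fun y => ψ (z - y)) y w = - fderiv ℝ ψ (z - y) w := by
  have : (fun y => ψ (z - y)) = fun y => (fun u => ψ (u + z)) ((-1 : ℝ) • y) := by
    ext y; congr 1; simp [sub_eq_neg_add]
  rw [this, fderiv_comp_smul (f := fun u => ψ (u + z)), fderiv_comp_add_right]
  simp [sub_eq_neg_add]

variable {G : Type*} [NormedAddCommGroup G] [NormedSpace ℝ G] [FiniteDimensional ℝ G]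
  {V : Type*} [NormedAddCommGroup V] [NormedSpace ℝ V]

variable (G) in
/-- A bump function of inner radius `1 / (2 (n + 1))` and outer radius `1 / (n + 1)`. -/
noncomputable def smallBump (n : ℕ) : ContDiffBump (0 : G) where
  rIn := 1 / (n + 1 : ℝ) / 2
  rOut := 1 / (n + 1 : ℝ)
  rIn_pos := by positivity
  rIn_lt_rOut := half_lt_self (by positivity)

/-- The ratio of outer to inner radius is always 2, so all the bumps are dilations of a single
profile. This gives the exact scaling of the gradient in `exists_integral_norm_fderiv_mollifier_le`.
-/
theorem smallBump_apply (n : ℕ) (z : G) :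
    smallBump G n z =
      (someContDiffBumpBase G).toFun 2 ((1 / (n + 1 : ℝ) / 2)⁻¹ • z) := by
  rw [ContDiffBump.apply, sub_zero]
  congr 1
  simp only [smallBump]
  field_simp

variable [MeasureSpace G]

variable (G) in
/-- A smooth approximation of the identity. -/
noncomputable def mollifier (n : ℕ) : G → ℝ := (smallBump G n).normed volume

/-- The convolution of `f` with the mollifier. -/
noncomputable def mollify (f : G → V) (n : ℕ) : G → V :=
  convolution (mollifier G n) f (ContinuousLinearMap.lsmul ℝ ℝ) volume

theorem contDiff_mollifier (n : ℕ) : ContDiff ℝ ∞ (mollifier G n) :=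
  (smallBump G n).contDiff_normed (n := ⊤)

theorem mollifier_nonneg (n : ℕ) (z : G) : 0 ≤ mollifier G n z := ContDiffBump.nonneg_normed _ _

variable [BorelSpace G] [(volume : Measure G).IsAddHaarMeasure]

theorem hasCompactSupport_mollifier (n : ℕ) : HasCompactSupport (mollifier G n) :=
  ContDiffBump.hasCompactSupport_normed _

theorem tsupport_mollifier (n : ℕ) :
    tsupport (mollifier G n) = Metric.closedBall 0 (1 / (n + 1 : ℝ)) :=
  (smallBump G n).tsupport_normed_eq

theorem integral_mollifier (n : ℕ) : ∫ z, mollifier G n z = 1 := ContDiffBump.integral_normed _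

theorem mollifier_eq_zero {n : ℕ} {z : G} (hz : 1 / (n + 1 : ℝ) < ‖z‖) : mollifier G n z = 0 :=
  image_eq_zero_of_notMem_tsupport (by simpa [tsupport_mollifier] using hz)

theorem fderiv_mollifier_eq_zero {n : ℕ} {z : G} (hz : 1 / (n + 1 : ℝ) < ‖z‖) :
    fderiv ℝ (mollifier G n) z = 0 :=
  image_eq_zero_of_notMem_tsupport fun h => by
    have := tsupport_fderiv_subset ℝ h
    rw [tsupport_mollifier] at this
    simp at this hz
    linarith

theorem contDiff_mollify {f : G → V} (hf : LocallyIntegrable f volume) (n : ℕ) :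
    ContDiff ℝ ∞ (mollify f n) :=
  (hasCompactSupport_mollifier n).contDiff_convolution_left (n := ⊤) _ (contDiff_mollifier n) hf

theorem mollify_apply (f : G → V) (n : ℕ) (z : G) :
    mollify f n z = ∫ y, mollifier G n (z - y) • f y := by
  rw [mollify, convolution_eq_swap]
  rfl

theorem ae_tendsto_mollify [CompleteSpace V] {f : G → V} (hf : LocallyIntegrable f volume) :
    ∀ᵐ z, Tendsto (fun n => mollify f n z) atTop (𝓝 (f z)) :=
  ContDiffBump.ae_convolution_tendsto_right_of_locallyIntegrable (φ := smallBump G) (K := 2)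
    tendsto_one_div_add_atTop_nhds_zero_nat
    (Eventually.of_forall fun n => by simp only [smallBump]; linarith) hf

theorem fderiv_mollify_apply {f : G → V} (hf : LocallyIntegrable f volume) (n : ℕ) (z w : G) :
    fderiv ℝ (mollify f n) z w = ∫ y, fderiv ℝ (mollifier G n) (z - y) w • f y := by
  have hc := hasCompactSupport_mollifier (G := G) n
  have hd : ContDiff ℝ 1 (mollifier G n) := (contDiff_mollifier n).of_le (by simp)
  have hder := hc.hasFDerivAt_convolution_left (ContinuousLinearMap.lsmul ℝ ℝ) hd hf z
  have hex := (hc.fderiv (𝕜 := ℝ)).convolutionExists_left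
    ((ContinuousLinearMap.lsmul ℝ ℝ : ℝ →L[ℝ] V →L[ℝ] V).precompL G)
    (hd.continuous_fderiv one_ne_zero) hf z
  rw [show mollify f n = convolution (mollifier G n) f (ContinuousLinearMap.lsmul ℝ ℝ) volume
    from rfl, hder.fderiv, convolution_def, ContinuousLinearMap.integral_apply hex,
    ← integral_sub_left_eq_self _ _ z]
  refine integral_congr_ae (Eventually.of_forall fun y => ?_)
  simp [ContinuousLinearMap.precompL_apply]

/-- The mollifications of a function with an essentially bounded weak derivative are uniformly
Lipschitz. -/
theorem lipschitzWith_mollify {f : G → V} (hf : LocallyIntegrable f volume)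
    {f' : G → G →L[ℝ] V} {L : ℝ≥0} (hL : ∀ᵐ x, ‖f' x‖ ≤ L)
    (hweak : ∀ φ : G → ℝ, ContDiff ℝ ∞ φ → HasCompactSupport φ →
      ∀ w : G, ∫ x, (fderiv ℝ φ x w) • f x = - ∫ x, φ x • f' x w) (n : ℕ) :
    LipschitzWith L (mollify f n) := by
  refine lipschitzWith_of_nnnorm_fderiv_le (𝕜 := ℝ)
    ((contDiff_mollify hf n).differentiable (by simp)) fun z => ?_
  rw [← NNReal.coe_le_coe, coe_nnnorm]
  refine ContinuousLinearMap.opNorm_le_bound _ L.coe_nonneg fun w => ?_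
  have key := hweak (fun y => mollifier G n (z - y))
    ((contDiff_mollifier n).comp (contDiff_const.sub contDiff_id))
    ((hasCompactSupport_mollifier n).comp_homeomorph (Homeomorph.subLeft z)) w
  simp only [fderiv_comp_sub_left, neg_smul, integral_neg, neg_inj] at key
  rw [fderiv_mollify_apply hf, key]
  calc ‖∫ y, mollifier G n (z - y) • f' y w‖
      ≤ ∫ y, mollifier G n (z - y) * (L * ‖w‖) := by
        refine norm_integral_le_of_norm_le ?_ ?_
        · refine Integrable.mul_const ?_ _
          exact ((contDiff_mollifier n).continuous.integrable_of_hasCompactSupport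
            (hasCompactSupport_mollifier n)).comp_sub_left z
        · filter_upwards [hL] with y hy
          rw [norm_smul, Real.norm_of_nonneg (mollifier_nonneg _ _)]
          refine mul_le_mul_of_nonneg_left ?_ (mollifier_nonneg _ _)
          exact ((f' y).le_opNorm w).trans (mul_le_mul_of_nonneg_right hy (norm_nonneg w))
    _ = L * ‖w‖ := by
        rw [integral_mul_const, integral_sub_left_eq_self (mollifier G n) volume z, integral_mollifier,
          one_mul]

theorem MeasureTheory.MemLp.exists_ae_norm_le {X W : Type*} [MeasureSpace X]
    [NormedAddCommGroup W] {u : X → W} (hu : MemLp u ∞ volume) :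
    ∃ L : ℝ≥0, ∀ᵐ x, ‖u x‖ ≤ L := by
  refine ⟨(eLpNorm u ∞ volume).toNNReal, ?_⟩
  filter_upwards [ae_le_eLpNormEssSup (f := u) (μ := volume)] with x hx
  rw [← eLpNorm_exponent_top] at hx
  have := ENNReal.toReal_mono hu.2.ne hx
  rwa [toReal_enorm] at this

/-- An essentially bounded function with an essentially bounded weak derivative has a bounded
Lipschitz representative. -/
theorem exists_lipschitz_representative [FiniteDimensional ℝ V] {f : G → V}
    {f' : G → G →L[ℝ] V} (hf : MemLp f ∞ volume) (hf' : MemLp f' ∞ volume)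
    (hweak : ∀ φ : G → ℝ, ContDiff ℝ ∞ φ → HasCompactSupport φ →
      ∀ w : G, ∫ x, (fderiv ℝ φ x w) • f x = - ∫ x, φ x • f' x w) :
    ∃ (g : G → V) (K : ℝ≥0) (M : ℝ), LipschitzWith K g ∧ (∀ x, ‖g x‖ ≤ M) ∧ f =ᵐ[volume] g := by
  have hloc : LocallyIntegrable f volume := hf.locallyIntegrable le_top
  obtain ⟨L, hL⟩ := hf'.exists_ae_norm_le
  obtain ⟨M, hM⟩ := hf.exists_ae_norm_le
  have hae := ae_tendsto_mollify hloc
  set s : Set G := {z | Tendsto (fun n => mollify f n z) atTop (𝓝 (f z)) ∧ ‖f z‖ ≤ M} with hs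
  have hsae : ∀ᵐ z, z ∈ s := hae.and hM
  have hlip : LipschitzOnWith L f s := by
    refine LipschitzOnWith.of_dist_le_mul fun x hx y hy => ?_
    exact le_of_tendsto (hx.1.dist hy.1)
      (Eventually.of_forall fun n => (lipschitzWith_mollify hloc hL hweak n).dist_le_mul x y)
  -- Extending a vector-valued map off the full-measure set `s` may enlarge the Lipschitz constant,
  -- which is harmless. The sup bound passes to the extension by density of `s`.
  obtain ⟨g, hg, hfg⟩ := hlip.extend_finite_dimension
  refine ⟨g, _, M, hg, fun x => ?_, hsae.mono fun z hz => hfg hz⟩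
  have hdense : Dense s := Measure.dense_of_ae hsae
  have hcl : IsClosed {x | ‖g x‖ ≤ M} := isClosed_le hg.continuous.norm continuous_const
  exact (closure_minimal (fun z hz => by rw [mem_ofPred_eq, ← hfg hz]; exact hz.2) hcl)
    (hdense x)

/-- The gradient of the mollifier at scale `δ` has `L¹` norm `O(δ⁻¹)`. -/
theorem exists_integral_norm_fderiv_mollifier_le (G : Type*) [NormedAddCommGroup G]
    [NormedSpace ℝ G] [FiniteDimensional ℝ G] [MeasureSpace G] [BorelSpace G]
    [(volume : Measure G).IsAddHaarMeasure] :
    ∃ C : ℝ≥0, ∀ n : ℕ,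
      ∫⁻ z : G, ENNReal.ofReal (1 / (n + 1 : ℝ) * ‖fderiv ℝ (mollifier G n) z‖) ≤ C := by
  set B : G → ℝ := (someContDiffBumpBase G).toFun 2 with hB
  refine ⟨(2 * (∫ z, B z)⁻¹ * ∫ z, ‖fderiv ℝ B z‖).toNNReal, fun n => ?_⟩
  have hcont : Continuous (fderiv ℝ (mollifier G n)) :=
    (contDiff_mollifier n).continuous_fderiv (by simp)
  have hcs : HasCompactSupport (fun z => ‖fderiv ℝ (mollifier G n) z‖) :=
    HasCompactSupport.norm (f := fderiv ℝ (mollifier G n)) ((hasCompactSupport_mollifier n).fderiv (𝕜 := ℝ))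
  have hint0 : Integrable (fun z => ‖fderiv ℝ (mollifier G n) z‖) :=
    hcont.norm.integrable_of_hasCompactSupport hcs
  rw [← ofReal_integral_eq_lintegral_ofReal (hint0.const_mul _)
    (Eventually.of_forall fun z => by positivity)]
  · refine ENNReal.ofReal_le_ofReal (le_of_eq ?_)
    -- Changing variables at scale r cancels every power of r except the r⁻¹ from the derivative,
    -- which the prefactor 2r absorbs; the result does not depend on n.
    set r : ℝ := 1 / (n + 1 : ℝ) / 2 with hr
    have hrpos : 0 < r := by positivity
    have hbump : ∀ z, smallBump G n z = B (r⁻¹ • z) := smallBump_apply n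
    have hint : ∫ z, smallBump G n z = r ^ Module.finrank ℝ G * ∫ z, B z := by
      simp only [hbump]
      rw [Measure.integral_comp_inv_smul, abs_of_pos (by positivity), smul_eq_mul]
    have hfd : ∀ z, fderiv ℝ (mollifier G n) z =
        ((r ^ Module.finrank ℝ G * ∫ z, B z)⁻¹ * r⁻¹) • fderiv ℝ B (r⁻¹ • z) := by
      intro z
      have : mollifier G n =
          (r ^ Module.finrank ℝ G * ∫ z, B z)⁻¹ • (fun z => B (r⁻¹ • z)) := by
        ext z
        rw [mollifier, ContDiffBump.normed_def, hint, hbump, Pi.smul_apply, smul_eq_mul,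
          div_eq_inv_mul]
      rw [this, fderiv_const_smul_field, Pi.smul_apply, fderiv_comp_smul, smul_smul]
    have hBint : 0 < r ^ Module.finrank ℝ G * ∫ z, B z := by
      rw [← hint]; exact (smallBump G n).integral_pos
    have hBpos : 0 < ∫ z, B z := pos_of_mul_pos_right hBint (by positivity)
    simp only [hfd, norm_smul]
    rw [integral_const_mul, integral_const_mul,
      Measure.integral_comp_inv_smul volume (fun z => ‖fderiv ℝ B z‖) r,
      abs_of_pos (by positivity : 0 < r ^ Module.finrank ℝ G), smul_eq_mul,
      Real.norm_of_nonneg (by positivity)]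
    rw [show (1 / (n + 1 : ℝ)) = 2 * r by rw [hr]; ring]
    field_simp

end Mollification

/-- A `W^{1,∞}` field has a bounded Lipschitz representative. -/
theorem MemW1Infty.exists_lipschitz {d : ℕ}
    {F : EuclideanSpace ℝ (Fin d) → EuclideanSpace ℝ (Fin d)} (hF : MemW1Infty F) :
    ∃ (F' : EuclideanSpace ℝ (Fin d) → EuclideanSpace ℝ (Fin d)) (K : NNReal) (M : ℝ),
      LipschitzWith K F' ∧ (∀ x, ‖F' x‖ ≤ M) ∧ F =ᵐ[volume] F' := by
  obtain ⟨h1, G, h2, h3⟩ := hF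
  exact exists_lipschitz_representative h1 h2 h3

/-- The field enters only under an integral in (x, v), and a null set of positions is a null set of
phase space. -/
theorem IsTransportDeriv.congr_field {d : ℕ}
    {F F' : EuclideanSpace ℝ (Fin d) → EuclideanSpace ℝ (Fin d)}
    {f g : EuclideanSpace ℝ (Fin d) × EuclideanSpace ℝ (Fin d) → ℝ}
    (h : IsTransportDeriv F f g) (hF : F =ᵐ[volume] F') : IsTransportDeriv F' f g := by
  intro φ h1 h2
  rw [← h φ h1 h2]
  refine integral_congr_ae ?_
  have hF' : F ∘ Prod.fst =ᵐ[volume] F' ∘ (Prod.fst (β := EuclideanSpace ℝ (Fin d))) :=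
    Measure.quasiMeasurePreserving_fst.ae_eq_comp hF
  filter_upwards [hF'] with z hz
  simp only [Function.comp_apply] at hz
  rw [hz]

/-! ### The commutator estimate and the variation of localized functions along the flow. -/

section TransportEstimate

open Filter
open scoped NNReal Topology

/-- Local form of Young's inequality `‖k ⋆ f‖₁ ≤ ‖k‖₁ ‖f‖₁`. -/
theorem setLIntegral_conv_le {G : Type*} [NormedAddCommGroup G] [SecondCountableTopology G]
    [MeasureSpace G] [BorelSpace G] [SFinite (volume : Measure G)]
    [(volume : Measure G).IsAddRightInvariant] {k f : G → ℝ≥0∞} (hk : Measurable k)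
    (hf : AEMeasurable f volume) (hk0 : ∀ z, 1 < ‖z‖ → k z = 0) {S : Set G}
    (hS : MeasurableSet S) :
    ∫⁻ z in S, ∫⁻ y, k (z - y) * f y ≤
      (∫⁻ z, k z) * ∫⁻ y in Metric.cthickening 1 S, f y := by
  set S' := Metric.cthickening 1 S with hS'
  have hmS' : MeasurableSet S' := Metric.isClosed_cthickening.measurableSet
  calc ∫⁻ z in S, ∫⁻ y, k (z - y) * f y
      ≤ ∫⁻ z in S, ∫⁻ y, k (z - y) * S'.indicator f y := by
        refine setLIntegral_mono' hS fun z hz => lintegral_mono fun y => ?_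
        by_cases hy : y ∈ S'
        · rw [indicator_of_mem hy]
        · rw [hk0 (z - y), zero_mul, zero_mul]
          by_contra! hle
          refine hy (Metric.mem_cthickening_of_dist_le y z 1 S hz ?_)
          rwa [dist_comm, dist_eq_norm]
    _ ≤ ∫⁻ z, ∫⁻ y, k (z - y) * S'.indicator f y := setLIntegral_le_lintegral _ _
    _ = ∫⁻ y, ∫⁻ z, k (z - y) * S'.indicator f y := by
        refine lintegral_lintegral_swap ?_
        exact (hk.comp (measurable_fst.sub measurable_snd)).aemeasurable.mul
          ((hf.indicator hmS').comp_quasiMeasurePreserving Measure.quasiMeasurePreserving_snd)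
    _ = ∫⁻ y, (∫⁻ z, k z) * S'.indicator f y := by
        refine lintegral_congr fun y => ?_
        rw [lintegral_mul_const _ (show Measurable fun z => k (z - y) by fun_prop),
          lintegral_sub_right_eq_self]
    _ = (∫⁻ z, k z) * ∫⁻ y in S', f y := by
        rw [lintegral_const_mul'' _ (hf.indicator hmS'), lintegral_indicator hmS']

variable {E : Type*} [NormedAddCommGroup E] [NormedSpace ℝ E] [FiniteDimensional ℝ E]
  [MeasureSpace E] [BorelSpace E] [(volume : Measure E).IsAddHaarMeasure]

/-- A `C¹` function varies along the flow, in `L¹`, at a rate at most the `L¹` norm of its transport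
derivative. -/
theorem IsKineticFlow.lintegral_comp_sub_le {F : E → E} {K : ℝ≥0} {M T : ℝ}
    {Φ : ℝ → E × E → E × E} (h : IsKineticFlow F K M T Φ) {u : E × E → ℝ} (hu : ContDiff ℝ 1 u)
    {t : ℝ} (ht : |t| ≤ T) :
    ∫⁻ z, ‖u (Φ t z) - u z‖ₑ ≤
      ENNReal.ofReal |t| * ∫⁻ z : E × E, ‖fderiv ℝ u z (z.2, F z.1)‖ₑ := by
  set D : E × E → ℝ := fun z => fderiv ℝ u z (z.2, F z.1) with hD
  have hDc : Continuous D :=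
    (hu.continuous_fderiv one_ne_zero).clm_apply
      (continuous_snd.prodMk (h.lipschitz.continuous.comp continuous_fst))
  have huIcc : ∀ s ∈ uIcc 0 t, |s| ≤ T := fun s hs => by
    have := abs_sub_left_of_mem_uIcc hs
    simp only [sub_zero] at this
    exact this.trans ht
  have hΦc : ContinuousOn (fun p : (E × E) × ℝ => D (Φ p.2 p.1)) (univ ×ˢ uIcc 0 t) :=
    hDc.comp_continuousOn (h.continuousOn_uncurry.mono
      (prod_mono_right fun s hs => h.abs_le_two_mul (huIcc s hs)))
  have hpt : ∀ z, ‖u (Φ t z) - u z‖ₑ ≤ ∫⁻ s in uIoc 0 t, ‖D (Φ s z)‖ₑ := by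
    intro z
    have hder : ∀ s ∈ uIcc 0 t, HasDerivAt (fun s => u (Φ s z)) (D (Φ s z)) s := fun s hs =>
      ((hu.differentiable one_ne_zero (Φ s z)).hasFDerivAt.comp_hasDerivAt s
        (h.hasDerivAt z s (h.abs_le_two_mul (huIcc s hs))))
    have hci : ContinuousOn (fun s => D (Φ s z)) (uIcc 0 t) :=
      hΦc.comp (f := fun s => (z, s)) (by fun_prop) fun s hs => ⟨mem_univ _, hs⟩
    have := intervalIntegral.integral_eq_sub_of_hasDerivAt hder hci.intervalIntegrable
    rw [h.zero] at this
    rw [← this, intervalIntegral.intervalIntegral_eq_integral_uIoc, enorm_smul]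
    have h1 : ‖(if (0 : ℝ) ≤ t then (1 : ℝ) else -1)‖ₑ = 1 := by split_ifs <;> simp
    rw [h1, one_mul]
    exact enorm_integral_le_lintegral_enorm _
  calc ∫⁻ z, ‖u (Φ t z) - u z‖ₑ ≤ ∫⁻ z, ∫⁻ s in uIoc 0 t, ‖D (Φ s z)‖ₑ := lintegral_mono hpt
    _ = ∫⁻ s in uIoc 0 t, ∫⁻ z, ‖D (Φ s z)‖ₑ := by
        refine lintegral_lintegral_swap ?_
        have hm : MeasurableSet (univ ×ˢ uIoc 0 t : Set ((E × E) × ℝ)) :=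
          MeasurableSet.univ.prod measurableSet_uIoc
        have := (hΦc.mono (prod_mono_right uIoc_subset_uIcc)).aemeasurable (μ := volume) hm
        have heq : (volume : Measure ((E × E) × ℝ)).restrict (univ ×ˢ uIoc 0 t) =
            (volume : Measure (E × E)).prod (volume.restrict (uIoc 0 t)) := by
          rw [Measure.volume_eq_prod, ← Measure.prod_restrict, Measure.restrict_univ]
        rw [heq] at this
        exact this.enorm
    _ = ∫⁻ _ in uIoc 0 t, ∫⁻ z, ‖D z‖ₑ := by
        refine setLIntegral_congr_fun measurableSet_uIoc fun s hs => ?_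
        exact (h.measurePreserving (huIcc s (uIoc_subset_uIcc hs))).lintegral_comp
          hDc.enorm.measurable
    _ = ENNReal.ofReal |t| * ∫⁻ z, ‖D z‖ₑ := by
        rw [setLIntegral_const, mul_comm]
        simp [uIoc, Real.volume_Ioc, abs_eq_max_neg, max_sub_min_eq_abs]

/-- The transport derivative of the mollification of `f` is the mollification of the transport
derivative of `f` up to a commutator. -/
theorem fderiv_mollify_transport {F : E → E} (hF : Continuous F) {f g : E × E → ℝ}
    (hf : LocallyIntegrable f volume)
    (hfg : ∀ φ : E × E → ℝ, ContDiff ℝ ∞ φ → HasCompactSupport φ →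
      ∫ z, f z * fderiv ℝ φ z (z.2, F z.1) = - ∫ z, g z * φ z) (n : ℕ) (z : E × E) :
    -- Testing the equation against the reflected mollifier centred at z produces the field at the
    -- integration point y; the left side carries the field at z, and the commutator is the
    -- difference.
    fderiv ℝ (mollify f n) z (z.2, F z.1) = mollify g n z +
      ∫ y, fderiv ℝ (mollifier (E × E) n) (z - y) ((z.2, F z.1) - (y.2, F y.1)) • f y := by
  have hcη := (contDiff_mollifier (G := E × E) n).continuous_fderiv (by simp)
  have hsη := (hasCompactSupport_mollifier (G := E × E) n).fderiv (𝕜 := ℝ)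
  have key := hfg (fun y => mollifier (E × E) n (z - y))
    ((contDiff_mollifier n).comp (contDiff_const.sub contDiff_id))
    ((hasCompactSupport_mollifier n).comp_homeomorph (Homeomorph.subLeft z))
  simp only [fderiv_comp_sub_left, mul_neg, integral_neg, neg_inj] at key
  have h1 : mollify g n z =
      ∫ y : E × E, fderiv ℝ (mollifier (E × E) n) (z - y) (y.2, F y.1) • f y := by
    rw [mollify_apply]
    simp only [smul_eq_mul, mul_comm _ (f _), mul_comm _ (g _)]
    exact key.symm
  have hsub : HasCompactSupport fun y => fderiv ℝ (mollifier (E × E) n) (z - y) :=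
    hsη.comp_homeomorph (Homeomorph.subLeft z)
  have hcsub : Continuous fun y => fderiv ℝ (mollifier (E × E) n) (z - y) :=
    hcη.comp (continuous_const.sub continuous_id)
  have hint : ∀ w : E × E → E × E, Continuous w →
      Integrable fun y => fderiv ℝ (mollifier (E × E) n) (z - y) (w y) • f y := fun w hw =>
    hf.integrable_smul_left_of_hasCompactSupport (hcsub.clm_apply hw)
      (hsub.mono fun y hy hy0 => hy (by simp [hy0]))
  rw [h1, fderiv_mollify_apply hf, ← integral_add (hint _ (by fun_prop)) (hint _ (by fun_prop))]
  simp only [map_sub, sub_smul, add_sub_cancel]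

theorem enorm_mollify_le {G : Type*} [NormedAddCommGroup G] [NormedSpace ℝ G]
    [FiniteDimensional ℝ G] [MeasureSpace G] [BorelSpace G] [(volume : Measure G).IsAddHaarMeasure]
    (f : G → ℝ) (n : ℕ) (z : G) :
    ‖mollify f n z‖ₑ ≤ ∫⁻ y, ENNReal.ofReal (mollifier G n (z - y)) * ‖f y‖ₑ := by
  rw [mollify_apply]
  refine (enorm_integral_le_lintegral_enorm _).trans (lintegral_mono fun y => ?_)
  rw [enorm_smul, Real.enorm_of_nonneg (mollifier_nonneg _ _)]

theorem one_div_succ_le_one (n : ℕ) : 1 / (n + 1 : ℝ) ≤ 1 := by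
  rw [div_le_one (by positivity)]
  linarith [(Nat.cast_nonneg n : (0 : ℝ) ≤ n)]

theorem setLIntegral_mollify_le {G : Type*} [NormedAddCommGroup G] [NormedSpace ℝ G]
    [FiniteDimensional ℝ G] [MeasureSpace G] [BorelSpace G] [(volume : Measure G).IsAddHaarMeasure]
    {f : G → ℝ} (hf : LocallyIntegrable f volume) (n : ℕ) {S : Set G} (hS : MeasurableSet S) :
    ∫⁻ z in S, ‖mollify f n z‖ₑ ≤ ∫⁻ z in Metric.cthickening 1 S, ‖f z‖ₑ := by
  calc ∫⁻ z in S, ‖mollify f n z‖ₑ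
      ≤ ∫⁻ z in S, ∫⁻ y, ENNReal.ofReal (mollifier G n (z - y)) * ‖f y‖ₑ :=
        lintegral_mono fun z => enorm_mollify_le f n z
    _ ≤ (∫⁻ z, ENNReal.ofReal (mollifier G n z)) * ∫⁻ z in Metric.cthickening 1 S, ‖f z‖ₑ :=
        setLIntegral_conv_le (k := fun z => ENNReal.ofReal (mollifier G n z))
          (contDiff_mollifier n).continuous.measurable.ennreal_ofReal
          hf.aestronglyMeasurable.enorm
          (fun z hz => by rw [mollifier_eq_zero ((one_div_succ_le_one n).trans_lt hz)]; simp) hS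
    _ = ∫⁻ z in Metric.cthickening 1 S, ‖f z‖ₑ := by
        rw [← ofReal_integral_eq_lintegral_ofReal
          ((contDiff_mollifier n).continuous.integrable_of_hasCompactSupport
            (hasCompactSupport_mollifier n)) (Eventually.of_forall (mollifier_nonneg n)),
          integral_mollifier, ENNReal.ofReal_one, one_mul]

/-- The transport derivatives of the mollifications of `f` are locally bounded in `L¹`. -/
theorem exists_setLIntegral_fderiv_mollify_le {F : E → E} {K : ℝ≥0} (hF : LipschitzWith K F)
    (hK : 1 ≤ K) : ∃ C : ℝ≥0, ∀ f g : E × E → ℝ, LocallyIntegrable f volume →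
      LocallyIntegrable g volume →
      (∀ φ : E × E → ℝ, ContDiff ℝ ∞ φ → HasCompactSupport φ →
        ∫ z, f z * fderiv ℝ φ z (z.2, F z.1) = - ∫ z, g z * φ z) →
      ∀ (n : ℕ) (S : Set (E × E)), MeasurableSet S →
        ∫⁻ z in S, ‖fderiv ℝ (mollify f n) z (z.2, F z.1)‖ₑ ≤
          (∫⁻ z in Metric.cthickening 1 S, ‖g z‖ₑ) +
            C * ∫⁻ z in Metric.cthickening 1 S, ‖f z‖ₑ := by
  obtain ⟨C, hC⟩ := exists_integral_norm_fderiv_mollifier_le (E × E)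
  refine ⟨K * C, fun f g hf hg hfg n S hS => ?_⟩
  set k : E × E → ℝ≥0∞ := fun z =>
    ENNReal.ofReal (1 / (n + 1 : ℝ) * ‖fderiv ℝ (mollifier (E × E) n) z‖) with hk
  have hkm : Measurable k :=
    ((contDiff_mollifier n).continuous_fderiv (by simp)).norm.measurable.const_mul _ |>.ennreal_ofReal
  -- Where the gradient of the mollifier is nonzero, |z − y| is at most the scale 1 / (n + 1), so
  -- the field varies by at most K / (n + 1). This compensates the gradient, whose L¹ norm is of
  -- order n + 1.
  have hcomm : ∀ z : E × E,
      ‖∫ y, fderiv ℝ (mollifier (E × E) n) (z - y) ((z.2, F z.1) - (y.2, F y.1)) • f y‖ₑ ≤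
        K * ∫⁻ y, k (z - y) * ‖f y‖ₑ := by
    intro z
    rw [← lintegral_const_mul' _ _ ENNReal.coe_ne_top]
    refine (enorm_integral_le_lintegral_enorm _).trans (lintegral_mono fun y => ?_)
    rw [enorm_smul, ← mul_assoc]
    gcongr
    rw [← ofReal_norm, hk, ← ENNReal.ofReal_coe_nnreal,
      ← ENNReal.ofReal_mul K.coe_nonneg]
    refine ENNReal.ofReal_le_ofReal ?_
    rcases lt_or_ge (1 / (n + 1 : ℝ)) ‖z - y‖ with hlt | hle
    · rw [fderiv_mollifier_eq_zero hlt]; simp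
    · have h1 : ‖(z.2, F z.1) - (y.2, F y.1)‖ ≤ K * ‖z - y‖ := by
        have := (hF.kineticField hK).dist_le_mul z y
        rwa [dist_eq_norm, dist_eq_norm] at this
      calc _ ≤ ‖fderiv ℝ (mollifier (E × E) n) (z - y)‖ * ‖(z.2, F z.1) - (y.2, F y.1)‖ :=
            ContinuousLinearMap.le_opNorm _ _
        _ ≤ ‖fderiv ℝ (mollifier (E × E) n) (z - y)‖ * (K * (1 / (n + 1 : ℝ))) :=
            mul_le_mul_of_nonneg_left (h1.trans (mul_le_mul_of_nonneg_left hle K.coe_nonneg))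
              (norm_nonneg _)
        _ = _ := by ring
  calc ∫⁻ z in S, ‖fderiv ℝ (mollify f n) z (z.2, F z.1)‖ₑ
      ≤ ∫⁻ z in S, (‖mollify g n z‖ₑ + K * ∫⁻ y, k (z - y) * ‖f y‖ₑ) := by
        refine lintegral_mono fun z => ?_
        rw [fderiv_mollify_transport hF.continuous hf hfg]
        exact (enorm_add_le _ _).trans (add_le_add le_rfl (hcomm z))
    _ = (∫⁻ z in S, ‖mollify g n z‖ₑ) + K * ∫⁻ z in S, ∫⁻ y, k (z - y) * ‖f y‖ₑ := by
        rw [lintegral_add_left (contDiff_mollify hg n).continuous.enorm.measurable,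
          lintegral_const_mul' _ _ ENNReal.coe_ne_top]
    _ ≤ (∫⁻ z in Metric.cthickening 1 S, ‖g z‖ₑ) +
          K * (C * ∫⁻ z in Metric.cthickening 1 S, ‖f z‖ₑ) := by
        refine add_le_add (setLIntegral_mollify_le hg n hS) (mul_le_mul_right ?_ _)
        · refine (setLIntegral_conv_le hkm hf.aestronglyMeasurable.enorm (fun z hz => ?_) hS).trans
            (mul_le_mul_left (hC n) _)
          simp only [hk]
          rw [fderiv_mollifier_eq_zero ((one_div_succ_le_one n).trans_lt hz)]
          simp
    _ = _ := by rw [ENNReal.coe_mul, mul_assoc]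

theorem BoundedInL1loc.exists_setLIntegral_le {X ι : Type*} [TopologicalSpace X] [T2Space X]
    [MeasureSpace X] [OpensMeasurableSpace X] {f : ι → X → ℝ} (hf : BoundedInL1loc f) {K : Set X}
    (hK : IsCompact K) : ∃ C : ℝ≥0, ∀ i, ∫⁻ z in K, ‖f i z‖ₑ ≤ C := by
  obtain ⟨C, hC⟩ := hf.2 K hK
  refine ⟨C.toNNReal, fun i => ?_⟩
  have := ofReal_integral_norm_eq_lintegral_enorm ((hf.1 i).integrableOn_isCompact hK)
  rw [← this]
  exact ENNReal.ofReal_le_ofReal (hC i)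

/-- After localization, the family `f` is uniformly Lipschitz in `L¹` along the flow. -/
theorem IsKineticFlow.exists_lintegral_mul_comp_sub_le {F : E → E} {K : ℝ≥0} {M T : ℝ}
    {Φ : ℝ → E × E → E × E} (h : IsKineticFlow F K M T Φ) {ι : Type*} {f g : ι → E × E → ℝ}
    (hf : BoundedInL1loc f) (hg : BoundedInL1loc g)
    (hfg : ∀ i, ∀ φ : E × E → ℝ, ContDiff ℝ ∞ φ → HasCompactSupport φ →
        ∫ z, f i z * fderiv ℝ φ z (z.2, F z.1) = - ∫ z, g i z * φ z)
    {χ : E × E → ℝ} (hχ : ContDiff ℝ 1 χ) (hχc : HasCompactSupport χ) :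
    ∃ C : ℝ≥0, ∀ i t, |t| ≤ T →
      ∫⁻ z, ‖χ (Φ t z) * f i (Φ t z) - χ z * f i z‖ₑ ≤ C * ENNReal.ofReal |t| := by
  set S := tsupport χ with hS
  have hSm : MeasurableSet S := (isClosed_tsupport χ).measurableSet
  have hS' : IsCompact (Metric.cthickening 1 S) := IsCompact.cthickening hχc
  obtain ⟨C₀, hC₀⟩ := exists_setLIntegral_fderiv_mollify_le h.lipschitz h.one_le
  obtain ⟨Cf, hCf⟩ := hf.exists_setLIntegral_le hS'
  obtain ⟨Cg, hCg⟩ := hg.exists_setLIntegral_le hS'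
  have hb : Continuous fun z : E × E => (z.2, F z.1) :=
    continuous_snd.prodMk (h.lipschitz.continuous.comp continuous_fst)
  have hχ'c : Continuous fun z : E × E => fderiv ℝ χ z (z.2, F z.1) :=
    (hχ.continuous_fderiv one_ne_zero).clm_apply hb
  have hχ's : HasCompactSupport fun z : E × E => fderiv ℝ χ z (z.2, F z.1) :=
    (hχc.fderiv (𝕜 := ℝ)).mono fun y hy hy0 => hy (by simp [hy0])
  obtain ⟨C₁, hC₁⟩ := hχ.continuous.bounded_above_of_compact_support hχc
  obtain ⟨C₂, hC₂⟩ := hχ'c.bounded_above_of_compact_support hχ's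
  have enorm_le : ∀ {a c : ℝ}, ‖a‖ ≤ c → ‖a‖ₑ ≤ (c.toNNReal : ℝ≥0∞) := fun hac => by
    rw [← ofReal_norm]; exact ENNReal.ofReal_le_ofReal hac
  refine ⟨C₁.toNNReal * (Cg + C₀ * Cf) + C₂.toNNReal * Cf, fun i t ht => ?_⟩
  -- Mollification precedes the cutoff, so the product rule bounds the transport derivative of `u n`
  -- in L¹ uniformly in both n and the index i.
  set u : ℕ → E × E → ℝ := fun n z => χ z * mollify (f i) n z with hu
  have hudiff : ∀ n, ContDiff ℝ 1 (u n) := fun n =>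
    hχ.mul ((contDiff_mollify (hf.1 i) n).of_le (by simp))
  have hfderiv : ∀ n (z : E × E), fderiv ℝ (u n) z (z.2, F z.1) =
      χ z * fderiv ℝ (mollify (f i) n) z (z.2, F z.1) +
        mollify (f i) n z * fderiv ℝ χ z (z.2, F z.1) := by
    intro n z
    have h1 := (hχ.differentiable one_ne_zero z)
    have h2 := ((contDiff_mollify (hf.1 i) n).differentiable (by simp) z)
    simp only [hu]
    rw [fderiv_fun_mul h1 h2]
    simp
  have hTu : ∀ n, ∫⁻ z : E × E, ‖fderiv ℝ (u n) z (z.2, F z.1)‖ₑ ≤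
      C₁.toNNReal * (Cg + C₀ * Cf) + C₂.toNNReal * Cf := by
    intro n
    calc ∫⁻ z : E × E, ‖fderiv ℝ (u n) z (z.2, F z.1)‖ₑ
        = ∫⁻ z in S, ‖fderiv ℝ (u n) z (z.2, F z.1)‖ₑ := by
          rw [setLIntegral_eq_of_support_subset]
          intro z hz
          by_contra hzS
          refine hz ?_
          simp only [hfderiv, image_eq_zero_of_notMem_tsupport hzS,
            image_eq_zero_of_notMem_tsupport (fun hmem => hzS (tsupport_fderiv_subset ℝ hmem))]
          simp
      _ ≤ ∫⁻ z in S, (C₁.toNNReal * ‖fderiv ℝ (mollify (f i) n) z (z.2, F z.1)‖ₑ +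
            C₂.toNNReal * ‖mollify (f i) n z‖ₑ) := by
          refine lintegral_mono fun z => ?_
          rw [hfderiv]
          refine (enorm_add_le _ _).trans ?_
          rw [enorm_mul, enorm_mul, mul_comm ‖mollify (f i) n z‖ₑ]
          gcongr
          · exact enorm_le (hC₁ z)
          · exact enorm_le (hC₂ z)
      _ = C₁.toNNReal * (∫⁻ z in S, ‖fderiv ℝ (mollify (f i) n) z (z.2, F z.1)‖ₑ) +
            C₂.toNNReal * ∫⁻ z in S, ‖mollify (f i) n z‖ₑ := by
          rw [lintegral_add_right _ ((contDiff_mollify (hf.1 i) n).continuous.enorm.measurable.const_mul _),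
            lintegral_const_mul' _ _ ENNReal.coe_ne_top,
            lintegral_const_mul' _ _ ENNReal.coe_ne_top]
      _ ≤ _ := by
          gcongr
          · refine (hC₀ (f i) (g i) (hf.1 i) (hg.1 i) (hfg i) n S hSm).trans ?_
            gcongr
            · exact hCg i
            · exact hCf i
          · exact (setLIntegral_mollify_le (hf.1 i) n hSm).trans (hCf i)
  have hlim := ae_tendsto_mollify (hf.1 i)
  -- Almost everywhere convergence also holds at `Φ t z`, since the flow pulls null sets back to
  -- null sets; Fatou's lemma then removes the mollification.
  have hlim' := (h.measurePreserving ht).quasiMeasurePreserving.ae hlim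
  have hcont := h.continuous (h.abs_le_two_mul ht)
  calc ∫⁻ z, ‖χ (Φ t z) * f i (Φ t z) - χ z * f i z‖ₑ
      = ∫⁻ z, liminf (fun n => ‖u n (Φ t z) - u n z‖ₑ) atTop := by
        refine lintegral_congr_ae ?_
        filter_upwards [hlim, hlim'] with z h1 h2
        exact (((h2.const_mul _).sub (h1.const_mul _)).enorm.liminf_eq).symm
    _ ≤ liminf (fun n => ∫⁻ z, ‖u n (Φ t z) - u n z‖ₑ) atTop :=
        lintegral_liminf_le fun n =>
          (((hudiff n).continuous.comp hcont).sub (hudiff n).continuous).enorm.measurable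
    _ ≤ _ := by
        refine liminf_le_of_le (by isBoundedDefault) fun b hb => ?_
        obtain ⟨n, hn⟩ := hb.exists
        refine hn.trans ((h.lintegral_comp_sub_le (hudiff n) ht).trans ?_)
        rw [mul_comm]
        gcongr
        push_cast
        exact hTu n

end TransportEstimate

/-! ### Cutoffs, sections, and the dispersion estimate for volumes. -/

section Equiintegrability

open Filter
open scoped NNReal Topology

theorem exists_pos_le_mul_le (C : ℝ≥0) {T η : ℝ} (hT : 0 < T) (hη : 0 < η) :
    ∃ t : ℝ, 0 < t ∧ t ≤ T ∧ C * t ≤ η := by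
  refine ⟨min T (η / (C + 1)), lt_min hT (by positivity), min_le_left _ _, ?_⟩
  calc (C : ℝ) * min T (η / (C + 1)) ≤ C * (η / (C + 1)) :=
        mul_le_mul_of_nonneg_left (min_le_right _ _) C.coe_nonneg
    _ ≤ η := by
        rw [mul_div_assoc', div_le_iff₀ (by positivity)]
        nlinarith [C.coe_nonneg]

theorem IsCompact.exists_contDiff_eq_one {G : Type*} [NormedAddCommGroup G] [NormedSpace ℝ G]
    [FiniteDimensional ℝ G] {S : Set G} (hS : IsCompact S) :
    ∃ χ : G → ℝ, ContDiff ℝ 1 χ ∧ (∀ z, χ z ∈ Icc (0 : ℝ) 1) ∧ HasCompactSupport χ ∧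
      ∀ z ∈ S, χ z = 1 := by
  obtain ⟨R, hR0, hR⟩ := hS.isBounded.subset_closedBall_lt 0 0
  let χ : ContDiffBump (0 : G) := ⟨R, R + 1, hR0, by linarith⟩
  exact ⟨χ, χ.contDiff, fun z => ⟨χ.nonneg, χ.le_one⟩, χ.hasCompactSupport,
    fun z hz => χ.one_of_mem_closedBall (hR hz)⟩

theorem lintegral_lintegral_section_indicator {E : Type*} [MeasureSpace E]
    [SFinite (volume : Measure E)] {f : E × E → ℝ} (hf : AEStronglyMeasurable f)
    {A K : Set (E × E)} (hA : MeasurableSet A) (hK : MeasurableSet K) :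
    ∫⁻ x, ∫⁻ v in {v | (x, v) ∈ A}, K.indicator (fun z => ‖f z‖ₑ) (x, v) =
      ∫⁻ z in A, K.indicator (fun z => ‖f z‖ₑ) z := by
  have hm : AEMeasurable (K.indicator (fun z => ‖f z‖ₑ)) := hf.enorm.indicator hK
  rw [← lintegral_indicator hA, Measure.volume_eq_prod, lintegral_prod _ (hm.indicator hA)]
  refine lintegral_congr fun x => ?_
  rw [← lintegral_indicator (show MeasurableSet {v | (x, v) ∈ A} from measurable_prodMk_left hA)]
  rfl

/-- An antilipschitz map increases Haar measure at most by a constant factor under preimages. -/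
theorem AntilipschitzWith.addHaar_preimage_le {E : Type*} [NormedAddCommGroup E] [NormedSpace ℝ E]
    [FiniteDimensional ℝ E] [MeasureSpace E] [BorelSpace E] [(volume : Measure E).IsAddHaarMeasure]
    {c : ℝ≥0} {u : E → E} (hu : AntilipschitzWith c u) (s : Set E) :
    volume (u ⁻¹' s) ≤ (c : ℝ≥0∞) ^ (Module.finrank ℝ E : ℝ) * volume s := by
  -- Volume is a multiple of Hausdorff measure of dimension `Module.finrank ℝ E`, for which the
  -- antilipschitz bound is available.
  have := MeasureTheory.isAddHaarMeasure_hausdorffMeasure (E := E)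
  rw [Measure.isAddLeftInvariant_eq_smul (volume : Measure E) (Measure.hausdorffMeasure (Module.finrank ℝ E))]
  simp only [Measure.smul_apply]
  rw [mul_smul_comm]
  gcongr
  exact hu.hausdorffMeasure_preimage_le (Nat.cast_nonneg _) s

variable {E : Type*} [NormedAddCommGroup E] [NormedSpace ℝ E] [FiniteDimensional ℝ E]
  [MeasureSpace E] [BorelSpace E] [(volume : Measure E).IsAddHaarMeasure]

/-- For `t ≠ 0`, the velocities that lead from `x` to a set `s` of positions in time `t` form a set
of measure at most a constant times the measure of `s`. -/
theorem IsKineticFlow.exists_volume_preimage_fst_le {F : E → E} {K : ℝ≥0} {M T : ℝ}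
    {Φ : ℝ → E × E → E × E} (h : IsKineticFlow F K M T Φ) {t : ℝ} (ht : |t| ≤ T) (ht0 : t ≠ 0) :
    ∃ C : ℝ≥0, ∀ (x : E) (s : Set E), volume {v | (Φ t (x, v)).1 ∈ s} ≤ C * volume s := by
  set c : ℝ≥0 := ⟨2 / |t|, by positivity⟩ with hc
  refine ⟨c ^ (Module.finrank ℝ E : ℝ), fun x s => ?_⟩
  have hanti : AntilipschitzWith c fun v => (Φ t (x, v)).1 := by
    refine AntilipschitzWith.of_le_mul_dist fun v w => ?_
    have := h.norm_sub_le_norm_fst_sub ht x v w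
    have ht' : 0 < |t| := abs_pos.2 ht0
    rw [dist_eq_norm, dist_eq_norm]
    change _ ≤ 2 / |t| * _
    rw [div_mul_eq_mul_div, le_div_iff₀ ht']
    linarith
  rw [ENNReal.coe_rpow_of_nonneg _ (Nat.cast_nonneg _)]
  exact hanti.addHaar_preimage_le s

end Equiintegrability

/-! ### From equiintegrability in v to equiintegrability in (x, v). -/

section EquiintegrableXV

open Filter
open scoped NNReal Topology

variable {d : ℕ} {ι : Type*}
  {f g : ι → EuclideanSpace ℝ (Fin d) × EuclideanSpace ℝ (Fin d) → ℝ}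
  {F : EuclideanSpace ℝ (Fin d) → EuclideanSpace ℝ (Fin d)} {K : ℝ≥0} {M T : ℝ}
  {Φ : ℝ → EuclideanSpace ℝ (Fin d) × EuclideanSpace ℝ (Fin d) →
    EuclideanSpace ℝ (Fin d) × EuclideanSpace ℝ (Fin d)}

/-- Equiintegrability in `v` in terms of sets of the product space. -/
theorem LocEquiintegrableV.exists_setLIntegral_le (hf : ∀ i, LocallyIntegrable (f i) volume)
    (hfv : LocEquiintegrableV f) {η : ℝ} (hη : 0 < η)
    {S : Set (EuclideanSpace ℝ (Fin d) × EuclideanSpace ℝ (Fin d))} (hS : IsCompact S) :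
    ∃ α : ℝ, 0 < α ∧ ∀ A : Set (EuclideanSpace ℝ (Fin d) × EuclideanSpace ℝ (Fin d)),
      MeasurableSet A → (∀ x, volume {v | (x, v) ∈ A} ≤ ENNReal.ofReal α) →
        ∀ i, ∫⁻ z in A, S.indicator (fun z => ‖f i z‖ₑ) z ≤ ENNReal.ofReal η := by
  obtain ⟨α, hα, h⟩ := hfv η hη S hS
  refine ⟨α / 2, by positivity, fun A hA hAx i => ?_⟩
  rw [← lintegral_lintegral_section_indicator (hf i).aestronglyMeasurable hA hS.measurableSet]
  refine h (fun x => {v | (x, v) ∈ A}) hA ?_ i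
  refine (iSup_le hAx).trans_lt ?_
  rw [ENNReal.ofReal_lt_ofReal_iff hα]
  linarith

/-- Only concentration in x has to be excluded. Following the flow for a fixed short time turns it
into concentration in v: a small set of final positions pulls back to a set with small v-sections.
-/
theorem IsKineticFlow.locEquiintegrableXV (h : IsKineticFlow F K M T Φ)
    (hf : BoundedInL1loc f) (hfv : LocEquiintegrableV f)
    (hfg : ∀ i, IsTransportDeriv F (f i) (g i)) (hg : BoundedInL1loc g) :
    LocEquiintegrableXV f := by
  intro η hη S hS
  obtain ⟨χ, hχsmooth, hχrange, hχsupp, hχone⟩ :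
      ∃ χ : EuclideanSpace ℝ (Fin d) × EuclideanSpace ℝ (Fin d) → ℝ, ContDiff ℝ 1 χ ∧
        (∀ z, χ z ∈ Icc (0 : ℝ) 1) ∧ HasCompactSupport χ ∧ ∀ z ∈ S, χ z = 1 :=
    hS.exists_contDiff_eq_one
  set S' := tsupport χ with hS'
  have hS'c : IsCompact S' := hχsupp
  obtain ⟨C, hC⟩ := h.exists_lintegral_mul_comp_sub_le hf hg hfg hχsmooth hχsupp
  obtain ⟨α₁, hα₁, hV₁⟩ := hfv.exists_setLIntegral_le hf.1 (by positivity : 0 < η / 2) hS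
  obtain ⟨α₂, hα₂, hV₂⟩ := hfv.exists_setLIntegral_le hf.1 (by positivity : 0 < η / 4) hS'c
  -- The time is fixed before the size of the sets: the dispersion constant `D` depends on t and
  -- degenerates as t → 0.
  obtain ⟨t, ht0, htT, htC⟩ : ∃ t : ℝ, 0 < t ∧ t ≤ T ∧ C * t ≤ η / 4 :=
    exists_pos_le_mul_le C h.pos (by positivity)
  have htabs : |t| ≤ T := by rwa [abs_of_pos ht0]
  obtain ⟨D, hD⟩ := h.exists_volume_preimage_fst_le htabs ht0.ne'
  have hΦm : MeasurePreserving (Φ t) := h.measurePreserving htabs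
  have hχS : ∀ z, ‖χ z‖ₑ ≤ 1 := fun z => by
    rw [Real.enorm_of_nonneg (hχrange z).1]
    exact ENNReal.ofReal_le_one.2 (hχrange z).2
  -- the mass over a set `B` of positions
  have hB : ∀ B : Set (EuclideanSpace ℝ (Fin d)), MeasurableSet B →
      D * volume B ≤ ENNReal.ofReal α₂ → ∀ i,
      ∫⁻ z in Prod.fst ⁻¹' B, ‖χ z * f i z‖ₑ ≤ ENNReal.ofReal (η / 2) := by
    intro B hBm hBα i
    set u : EuclideanSpace ℝ (Fin d) × EuclideanSpace ℝ (Fin d) → ℝ := fun z => χ z * f i z with hu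
    have hum : AEStronglyMeasurable u :=
      hχsmooth.continuous.aestronglyMeasurable.mul (hf.1 i).aestronglyMeasurable
    have hBm' : MeasurableSet (Prod.fst ⁻¹' B :
      Set (EuclideanSpace ℝ (Fin d) × EuclideanSpace ℝ (Fin d))) := measurable_fst hBm
    have hpre : MeasurableSet (Φ t ⁻¹' (Prod.fst ⁻¹' B)) := hΦm.measurable hBm'
    calc ∫⁻ z in Prod.fst ⁻¹' B, ‖u z‖ₑ
        = ∫⁻ z in Φ t ⁻¹' (Prod.fst ⁻¹' B), ‖u (Φ t z)‖ₑ := by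
          rw [← hΦm.map_eq] at hum
          conv_lhs => rw [← hΦm.map_eq]
          rw [← lintegral_indicator hBm', ← lintegral_indicator hpre,
            lintegral_map' (hum.enorm.indicator hBm') hΦm.measurable.aemeasurable]
          rfl
      _ ≤ ∫⁻ z in Φ t ⁻¹' (Prod.fst ⁻¹' B), (‖u z‖ₑ + ‖u (Φ t z) - u z‖ₑ) := by
          refine lintegral_mono fun z => ?_
          calc ‖u (Φ t z)‖ₑ = ‖u z + (u (Φ t z) - u z)‖ₑ := by rw [add_sub_cancel]
            _ ≤ _ := enorm_add_le _ _
      _ = (∫⁻ z in Φ t ⁻¹' (Prod.fst ⁻¹' B), ‖u z‖ₑ) +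
            ∫⁻ z in Φ t ⁻¹' (Prod.fst ⁻¹' B), ‖u (Φ t z) - u z‖ₑ :=
          lintegral_add_left' hum.enorm.restrict _
      _ ≤ (∫⁻ z in Φ t ⁻¹' (Prod.fst ⁻¹' B), S'.indicator (fun z => ‖f i z‖ₑ) z) +
            ∫⁻ z, ‖u (Φ t z) - u z‖ₑ := by
          refine add_le_add (lintegral_mono fun z => ?_) (setLIntegral_le_lintegral _ _)
          by_cases hz : z ∈ S'
          · rw [indicator_of_mem hz, hu, enorm_mul]
            exact mul_le_of_le_one_left' (hχS z)
          · simp [hu, image_eq_zero_of_notMem_tsupport hz]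
      _ ≤ ENNReal.ofReal (η / 4) + ENNReal.ofReal (η / 4) := by
          refine add_le_add (hV₂ _ hpre (fun x => (hD x B).trans hBα) i) ((hC i t htabs).trans ?_)
          rw [abs_of_pos ht0, ← ENNReal.ofReal_coe_nnreal, ← ENNReal.ofReal_mul C.coe_nonneg]
          exact ENNReal.ofReal_le_ofReal htC
      _ = ENNReal.ofReal (η / 2) := by
          rw [← ENNReal.ofReal_add (by positivity) (by positivity)]
          congr 1
          ring
  -- Chebyshev's inequality bounds the set `B` of positions whose section has volume at least α₁ by
  -- α₂ / (D + 1), hence D|B| ≤ α₂. The 1 covers the case D = 0.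
  refine ⟨α₁ * (α₂ / (D + 1)), by positivity, fun A hA hAα i => ?_⟩
  set B : Set (EuclideanSpace ℝ (Fin d)) := {x | ENNReal.ofReal α₁ ≤ volume {v | (x, v) ∈ A}}
    with hBdef
  have hsec : Measurable fun x => volume {v | (x, v) ∈ A} := measurable_measure_prodMk_left hA
  have hBm : MeasurableSet B := measurableSet_le measurable_const hsec
  have hα₁' : ENNReal.ofReal α₁ ≠ 0 := by simpa using hα₁
  have hBvol : volume B ≤ ENNReal.ofReal (α₂ / (D + 1)) := by
    have h1 : ENNReal.ofReal α₁ * volume B ≤ volume A := by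
      calc ENNReal.ofReal α₁ * volume B ≤ ∫⁻ x, volume {v | (x, v) ∈ A} :=
            mul_meas_ge_le_lintegral hsec _
        _ = volume A := by rw [Measure.volume_eq_prod, Measure.prod_apply hA]; rfl
    have h2 := h1.trans hAα.le
    rw [ENNReal.ofReal_mul hα₁.le] at h2
    exact (ENNReal.mul_le_mul_iff_right hα₁' ENNReal.ofReal_ne_top).1 h2
  have hBα : D * volume B ≤ ENNReal.ofReal α₂ := by
    calc D * volume B ≤ D * ENNReal.ofReal (α₂ / (D + 1)) := by gcongr
      _ = ENNReal.ofReal (D * (α₂ / (D + 1))) := by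
          rw [ENNReal.ofReal_mul D.coe_nonneg, ENNReal.ofReal_coe_nnreal]
      _ ≤ ENNReal.ofReal α₂ := by
          refine ENNReal.ofReal_le_ofReal ?_
          rw [mul_div_assoc', div_le_iff₀ (by positivity)]
          nlinarith [D.coe_nonneg]
  have hBpre : MeasurableSet (Prod.fst ⁻¹' B :
    Set (EuclideanSpace ℝ (Fin d) × EuclideanSpace ℝ (Fin d))) := measurable_fst hBm
  calc ∫⁻ z in A, S.indicator (fun z => ‖f i z‖ₑ) z
      ≤ ∫⁻ z in A \ Prod.fst ⁻¹' B ∪ Prod.fst ⁻¹' B, S.indicator (fun z => ‖f i z‖ₑ) z :=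
        lintegral_mono_set (by rw [sdiff_union_self]; exact subset_union_left)
    _ ≤ (∫⁻ z in A \ Prod.fst ⁻¹' B, S.indicator (fun z => ‖f i z‖ₑ) z) +
          ∫⁻ z in Prod.fst ⁻¹' B, S.indicator (fun z => ‖f i z‖ₑ) z :=
        lintegral_union_le _ _ _
    _ ≤ ENNReal.ofReal (η / 2) + ENNReal.ofReal (η / 2) := by
        refine add_le_add (hV₁ _ (hA.diff hBpre) (fun x => ?_) i)
          ((lintegral_mono fun z => ?_).trans (hB B hBm hBα i))
        · by_cases hx : x ∈ B
          · have : {v | (x, v) ∈ A \ Prod.fst ⁻¹' B} = ∅ := by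
              ext v; simp [hx]
            rw [this]; simp
          · have hlt : volume {v | (x, v) ∈ A} < ENNReal.ofReal α₁ := by simpa [hBdef] using hx
            exact (measure_mono fun v hv => hv.1).trans hlt.le
        · by_cases hz : z ∈ S
          · rw [indicator_of_mem hz, hχone z hz, one_mul]
          · simp [hz]
    _ = ENNReal.ofReal η := by
        rw [← ENNReal.ofReal_add (by positivity) (by positivity)]
        congr 1
        ring

end EquiintegrableXV

/-! ### Weak compactness and densities in L². -/

section WeakCompactness

open Filter
open scoped NNReal Topology

/-- Bounded sequences of `L²` have weakly convergent subsequences. -/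
theorem exists_weak_limit_of_integral_sq_le {X : Type*} [MeasurableSpace X] {μ : Measure X}
    [IsSeparable μ] {φ : ℕ → X → ℝ} (hφ : ∀ n, MemLp (φ n) 2 μ) {R : ℝ}
    (hR : ∀ n, ∫ x, φ n x ^ 2 ∂μ ≤ R) :
    ∃ ψ : X → ℝ, Measurable ψ ∧ MemLp ψ 2 μ ∧ ∃ σ : ℕ → ℕ, StrictMono σ ∧
      ∀ k : X → ℝ, MemLp k 2 μ →
        Tendsto (fun n => ∫ x, k x * φ (σ n) x ∂μ) atTop (𝓝 (∫ x, k x * ψ x ∂μ)) := by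
  have : Fact ((2 : ℝ≥0∞) ≠ ⊤) := ⟨by simp⟩
  have : SecondCountableTopology (Lp ℝ 2 μ) := inferInstance
  have hinner : ∀ a b : Lp ℝ 2 μ, inner ℝ a b = ∫ x, b x * a x ∂μ := fun a b => by
    rw [L2.inner_def]; rfl
  have hnorm : ∀ n, ‖(hφ n).toLp‖ ≤ √R := fun n => by
    refine Real.le_sqrt_of_sq_le ?_
    rw [← real_inner_self_eq_norm_sq, hinner]
    refine le_of_eq_of_le (integral_congr_ae ?_) (hR n)
    filter_upwards [(hφ n).coeFn_toLp] with x hx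
    rw [hx, sq]
  obtain ⟨a, -, σ, hσ, hlim⟩ := WeakDual.isSeqCompact_closedBall ℝ (Lp ℝ 2 μ) 0 (√R)
    (x := fun n => StrongDual.toWeakDual (InnerProductSpace.toDual ℝ (Lp ℝ 2 μ) (hφ n).toLp))
    (fun n => by
      change InnerProductSpace.toDual ℝ (Lp ℝ 2 μ) (hφ n).toLp ∈ Metric.closedBall 0 (√R)
      rw [mem_closedBall_zero_iff, LinearIsometryEquiv.norm_map]
      exact hnorm n)
  set b : Lp ℝ 2 μ := (InnerProductSpace.toDual ℝ (Lp ℝ 2 μ)).symm (WeakDual.toStrongDual a) with hb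
  have hba : ∀ k, a k = inner ℝ b k := fun k => by
    rw [hb, InnerProductSpace.toDual_symm_apply]; rfl
  refine ⟨b, (Lp.stronglyMeasurable b).measurable, Lp.memLp b, σ, hσ, fun k hk => ?_⟩
  have h1 := ((WeakDual.eval_continuous (𝕜 := ℝ) hk.toLp).tendsto a).comp hlim
  have h2 : ∀ c : Lp ℝ 2 μ, inner ℝ c hk.toLp = ∫ x, k x * c x ∂μ := fun c => by
    rw [hinner]
    refine integral_congr_ae ?_
    filter_upwards [hk.coeFn_toLp] with x hx
    rw [hx]
  rw [hba, h2] at h1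
  refine h1.congr fun n => ?_
  change inner ℝ (hφ (σ n)).toLp hk.toLp = _
  rw [h2]
  refine integral_congr_ae ?_
  filter_upwards [(hφ (σ n)).coeFn_toLp] with x hx
  rw [hx]

/-- A finite measure dominated by a multiple of `μ` has a density in `L²(μ)`. -/
theorem exists_memLp_two_density {X : Type*} [MeasurableSpace X] {μ ν : Measure X} [SigmaFinite μ]
    [IsFiniteMeasure ν] {C : ℝ≥0} (hν : ν ≤ C • μ) :
    ∃ k : X → ℝ, MemLp k 2 μ ∧ ∀ w : X → ℝ, ∫ x, w x ∂ν = ∫ x, k x * w x ∂μ := by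
  have hac : ν ≪ μ := (Measure.absolutelyContinuous_of_le hν).trans
    (Measure.AbsolutelyContinuous.rfl.smul_left C)
  refine ⟨fun x => (ν.rnDeriv μ x).toReal, ?_, fun w => (integral_rnDeriv_smul hac).symm⟩
  have hm : Measurable fun x => (ν.rnDeriv μ x).toReal := (ν.measurable_rnDeriv μ).ennreal_toReal
  -- The density k is at most C, so k² ≤ C k, and k is integrable because `ν` is finite.
  have hle : ν.rnDeriv μ ≤ᵐ[μ] fun _ => (C : ℝ≥0∞) := by
    refine ae_le_of_forall_setLIntegral_le_of_sigmaFinite (ν.measurable_rnDeriv μ) fun s _ _ => ?_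
    rw [setLIntegral_const]
    exact (Measure.setLIntegral_rnDeriv_le s).trans (hν s)
  rw [memLp_two_iff_integrable_sq hm.aestronglyMeasurable]
  refine Integrable.mono' ((Measure.integrable_toReal_rnDeriv (μ := ν) (ν := μ)).const_mul (C : ℝ))
    (hm.pow_const 2).aestronglyMeasurable ?_
  filter_upwards [hle] with x hx
  have h1 : (ν.rnDeriv μ x).toReal ≤ C := by
    simpa using ENNReal.toReal_mono ENNReal.coe_ne_top hx
  rw [Real.norm_of_nonneg (by positivity), sq]
  exact mul_le_mul_of_nonneg_right h1 ENNReal.toReal_nonneg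

theorem abs_mul_le_sq_add_sq_div (a b : ℝ) {l : ℝ} (hl : 0 < l) :
    |a * b| ≤ l * a ^ 2 + b ^ 2 / l := by
  have h1 : l * a ^ 2 + b ^ 2 / l = (l * |a|) ^ 2 / l + |b| ^ 2 / l := by
    rw [mul_pow, sq_abs, sq_abs]; field_simp
  rw [h1, abs_mul, ← add_div, le_div_iff₀ hl]
  nlinarith [sq_nonneg (l * |a| - |b|), abs_nonneg a, abs_nonneg b,
    mul_nonneg (mul_nonneg hl.le (abs_nonneg a)) (abs_nonneg b)]

/-- A weighted substitute for the Cauchy–Schwarz inequality. In its applications l is chosen small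
against the factor that is merely bounded, and then the other factor is taken small against l. -/
theorem abs_integral_mul_le {X : Type*} [MeasurableSpace X] {μ : Measure X} {a b : X → ℝ}
    (ha : MemLp a 2 μ) (hb : MemLp b 2 μ) {l : ℝ} (hl : 0 < l) :
    |∫ x, a x * b x ∂μ| ≤ l * ∫ x, a x ^ 2 ∂μ + (∫ x, b x ^ 2 ∂μ) / l := by
  rw [← Real.norm_eq_abs, ← integral_const_mul, ← integral_div,
    ← integral_add (ha.integrable_sq.const_mul _) (hb.integrable_sq.div_const _)]
  refine norm_integral_le_of_norm_le ((ha.integrable_sq.const_mul _).add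
    (hb.integrable_sq.div_const _)) (Eventually.of_forall fun x => ?_)
  exact abs_mul_le_sq_add_sq_div _ _ hl

end WeakCompactness

/-! ### Decorrelation of positions at two distinct times. -/

section OffDiagonal

open Filter
open scoped NNReal Topology

variable {E : Type*} [NormedAddCommGroup E] [NormedSpace ℝ E] [FiniteDimensional ℝ E]
  [MeasureSpace E] [BorelSpace E] {F : E → E} {K : ℝ≥0} {M T : ℝ} {Φ : ℝ → E × E → E × E}

namespace IsKineticFlow

theorem measurableEmbedding (h : IsKineticFlow F K M T Φ) {t : ℝ} (ht : |t| ≤ T) :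
    MeasurableEmbedding (Φ t) :=
  (h.continuous (h.abs_le_two_mul ht)).measurableEmbedding
    (Function.LeftInverse.injective (h.neg_comp_self ht))

theorem measurable_comp_fst (h : IsKineticFlow F K M T Φ) {t : ℝ} (ht : |t| ≤ T) {w : E → ℝ}
    (hw : Measurable w) : Measurable fun z => w (Φ t z).1 :=
  hw.comp (measurable_fst.comp (h.continuous (h.abs_le_two_mul ht)).measurable)

variable [(volume : Measure E).IsAddHaarMeasure]

/-- Functions of the position only, transported by the flow, are bounded in `L¹` on sets of bounded
velocity. -/
theorem exists_setLIntegral_comp_fst_le (h : IsKineticFlow F K M T Φ) {A : Set (E × E)}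
    (hA : Bornology.IsBounded A) (hAm : MeasurableSet A) :
    ∃ C : ℝ≥0, ∀ t, |t| ≤ T → ∀ w : E → ℝ≥0∞, Measurable w →
      ∫⁻ z in A, w (Φ t z).1 ≤ C * ∫⁻ x, w x := by
  obtain ⟨r, hr⟩ := hA.subset_closedBall 0
  set Q : Set E := Metric.closedBall 0 (r + M * T) with hQ
  have hQm : MeasurableSet Q := Metric.isClosed_closedBall.measurableSet
  have hQfin : volume Q ≠ ⊤ := measure_closedBall_lt_top.ne
  refine ⟨(volume Q).toNNReal, fun t ht w hw => ?_⟩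
  rw [ENNReal.coe_toNNReal hQfin]
  have hm : Measurable (fun z : E × E => w z.1 * Q.indicator 1 z.2) :=
    (hw.comp measurable_fst).mul ((measurable_one.indicator hQm).comp measurable_snd)
  calc ∫⁻ z in A, w (Φ t z).1
      -- Velocities starting in `A` are still in the ball `Q` at time t. With this indicator
      -- inserted, the integral extends to the whole space, where the flow can be removed by measure
      -- preservation.
      ≤ ∫⁻ z in A, w (Φ t z).1 * Q.indicator 1 (Φ t z).2 := by
        refine setLIntegral_mono' hAm fun z hz => ?_
        have hmem : (Φ t z).2 ∈ Q := by
          have h1 := h.norm_snd_sub_le z (h.abs_le_two_mul ht)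
          have h2 := norm_le_norm_add_norm_sub z.2 (Φ t z).2
          have h3 : ‖z.2‖ ≤ r := (norm_snd_le z).trans (by simpa using hr hz)
          have h4 := mul_le_mul_of_nonneg_left ht h.bound_nonneg
          rw [norm_sub_rev] at h2
          rw [hQ, mem_closedBall_zero_iff]
          linarith
        rw [indicator_of_mem hmem]
        simp
    _ ≤ ∫⁻ z, w (Φ t z).1 * Q.indicator 1 (Φ t z).2 := setLIntegral_le_lintegral _ _
    _ = ∫⁻ z : E × E, w z.1 * Q.indicator 1 z.2 := (h.measurePreserving ht).lintegral_comp hm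
    _ = (∫⁻ x, w x) * ∫⁻ v, Q.indicator 1 v := by
        rw [Measure.volume_eq_prod]
        exact lintegral_prod_mul hw.aemeasurable (measurable_one.indicator hQm).aemeasurable
    _ = volume Q * ∫⁻ x, w x := by rw [lintegral_indicator_one hQm, mul_comm]

theorem exists_integral_comp_fst_sq_le (h : IsKineticFlow F K M T Φ) {A : Set (E × E)}
    (hA : Bornology.IsBounded A) (hAm : MeasurableSet A) :
    ∃ C : ℝ≥0, ∀ t, |t| ≤ T → ∀ w : E → ℝ, Measurable w → MemLp w 2 volume →
      MemLp (fun z => w (Φ t z).1) 2 (volume.restrict A) ∧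
      ∫ z in A, w (Φ t z).1 ^ 2 ≤ C * ∫ x, w x ^ 2 := by
  obtain ⟨C, hC⟩ := h.exists_setLIntegral_comp_fst_le hA hAm
  refine ⟨C, fun t ht w hw hw2 => ?_⟩
  have hm := h.measurable_comp_fst ht hw
  have hsq := hw2.integrable_sq
  have hlin : ∫⁻ z in A, ENNReal.ofReal (w (Φ t z).1 ^ 2) ≤
      ENNReal.ofReal (C * ∫ x, w x ^ 2) := by
    refine (hC t ht (fun x => ENNReal.ofReal (w x ^ 2)) (hw.pow_const 2).ennreal_ofReal).trans ?_
    rw [← ofReal_integral_eq_lintegral_ofReal hsq (Eventually.of_forall fun x => sq_nonneg _),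
      ENNReal.ofReal_mul C.coe_nonneg, ENNReal.ofReal_coe_nnreal]
  have hint : Integrable (fun z => w (Φ t z).1 ^ 2) (volume.restrict A) := by
    refine ⟨(hm.pow_const 2).aestronglyMeasurable, ?_⟩
    rw [hasFiniteIntegral_iff_ofReal (Eventually.of_forall fun z => sq_nonneg _)]
    exact hlin.trans_lt ENNReal.ofReal_lt_top
  refine ⟨(memLp_two_iff_integrable_sq hm.aestronglyMeasurable).2 hint, ?_⟩
  rw [← ofReal_integral_eq_lintegral_ofReal hint (Eventually.of_forall fun z => sq_nonneg _)] at hlin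
  refine (ENNReal.ofReal_le_ofReal_iff ?_).1 hlin
  have : 0 ≤ ∫ x, w x ^ 2 := integral_nonneg fun x => sq_nonneg _
  positivity

/-- The positions at two different times decorrelate in the weak limit. -/
theorem tendsto_setIntegral_mul_comp_fst (h : IsKineticFlow F K M T Φ) {t : ℝ} (ht : |t| ≤ T)
    (ht0 : t ≠ 0) {A : Set (E × E)} (hA : Bornology.IsBounded A) (hAm : MeasurableSet A)
    {w : ℕ → E → ℝ} (hwm : ∀ n, Measurable (w n)) (hw : ∀ n, MemLp (w n) 2 volume) {R : ℝ}
    (hR : ∀ n, ∫ x, w n x ^ 2 ≤ R)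
    (hlim : ∀ k : E → ℝ, MemLp k 2 volume → Tendsto (fun n => ∫ x, k x * w n x) atTop (𝓝 0)) :
    Tendsto (fun n => ∫ z in A, w n z.1 * w n (Φ t z).1) atTop (𝓝 0) := by
  obtain ⟨r, hr⟩ := hA.subset_closedBall 0
  set Q : Set E := Metric.closedBall 0 r with hQ
  have hQm : MeasurableSet Q := Metric.isClosed_closedBall.measurableSet
  have hQfin : volume Q < ⊤ := measure_closedBall_lt_top
  have hAQ : ∀ x v, (x, v) ∈ A → x ∈ Q ∧ v ∈ Q := fun x v hxv => by
    have := hr hxv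
    rw [mem_closedBall_zero_iff, Prod.norm_def, max_le_iff] at this
    simpa [hQ] using this
  have hR0 : 0 ≤ R := (integral_nonneg fun x => sq_nonneg _).trans (hR 0)
  obtain ⟨C, hC⟩ := h.exists_volume_preimage_fst_le ht ht0
  have hsecm : ∀ x, MeasurableSet {v | (x, v) ∈ A} := fun x => measurable_prodMk_left hAm
  have hXm : ∀ x, Measurable fun v => (Φ t (x, v)).1 := fun x =>
    measurable_fst.comp ((h.continuous (h.abs_le_two_mul ht)).measurable.comp measurable_prodMk_left)
  -- `ν x` is the law of the position at time t for particles leaving x with velocities in the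
  -- section of `A`. By dispersion it has an L² density, so weak convergence of w_n gives `G n x` →
  -- 0 for every x.
  set ν : E → Measure E := fun x =>
    (volume.restrict {v | (x, v) ∈ A}).map fun v => (Φ t (x, v)).1 with hν
  have hsecle : ∀ x, volume {v | (x, v) ∈ A} ≤ volume Q := fun x =>
    measure_mono fun v hv => (hAQ x v hv).2
  have hνfin : ∀ x, IsFiniteMeasure (ν x) := fun x => by
    have : IsFiniteMeasure (volume.restrict {v | (x, v) ∈ A}) :=
      ⟨by simpa using (hsecle x).trans_lt hQfin⟩
    infer_instance
  have hνle : ∀ x, ν x ≤ C • volume := fun x => by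
    refine Measure.le_iff.2 fun s hs => ?_
    rw [hν, Measure.map_apply (hXm x) hs]
    exact (Measure.restrict_apply_le _ _).trans (hC x s)
  set G : ℕ → E → ℝ := fun n x => ∫ v in {v | (x, v) ∈ A}, w n (Φ t (x, v)).1 with hG
  have hGν : ∀ n x, G n x = ∫ y, w n y ∂(ν x) := fun n x =>
    (integral_map (hXm x).aemeasurable (hwm n).aestronglyMeasurable).symm
  have hGlim : ∀ x, Tendsto (fun n => G n x) atTop (𝓝 0) := fun x => by
    obtain ⟨k, hk, hkw⟩ := exists_memLp_two_density (hνle x)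
    simp only [hGν, hkw]
    exact hlim k hk
  -- From |w| ≤ 1 + w² one gets a bound uniform in n and x; dominated convergence then makes `G n`
  -- tend to 0 strongly in L², which can be paired with the bounded sequence `w n`.
  have hGbound : ∀ n x, ‖G n x‖ ≤ Q.indicator (fun _ => (volume Q).toReal + C * R) x := by
    intro n x
    by_cases hx : x ∈ Q
    · rw [indicator_of_mem hx, hGν]
      have hsq : Integrable (fun y => w n y ^ 2) (ν x) :=
        ((hw n).integrable_sq.smul_measure_nnreal (c := C)).mono_measure (hνle x)
      calc ‖∫ y, w n y ∂(ν x)‖ ≤ ∫ y, (1 + w n y ^ 2) ∂(ν x) := by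
            refine norm_integral_le_of_norm_le ((integrable_const _).add hsq)
              (Eventually.of_forall fun y => ?_)
            rw [Real.norm_eq_abs, ← sq_abs]
            nlinarith [sq_nonneg (|w n y| - 1)]
        _ = (ν x).real univ + ∫ y, w n y ^ 2 ∂(ν x) := by
            rw [integral_add (integrable_const _) hsq]; simp
        _ ≤ (volume Q).toReal + C * R := by
            refine add_le_add ?_ ?_
            · refine ENNReal.toReal_mono hQfin.ne ?_
              rw [hν, Measure.map_apply (hXm x) MeasurableSet.univ]
              simpa using hsecle x
            · calc ∫ y, w n y ^ 2 ∂(ν x) ≤ ∫ y, w n y ^ 2 ∂(C • volume) :=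
                    integral_mono_measure (hνle x) (Eventually.of_forall fun y => sq_nonneg _)
                      ((hw n).integrable_sq.smul_measure_nnreal)
                _ = C * ∫ y, w n y ^ 2 := by
                    rw [integral_smul_nnreal_measure]; rfl
                _ ≤ C * R := mul_le_mul_of_nonneg_left (hR n) C.coe_nonneg
    · rw [indicator_of_notMem hx]
      have : {v | (x, v) ∈ A} = ∅ := by
        ext v; simp only [mem_ofPred_eq, mem_empty_iff_false, iff_false]
        exact fun hv => hx (hAQ x v hv).1
      simp [hG, this]
  have hGeq : ∀ n x, G n x = ∫ v, A.indicator (fun z => w n (Φ t z).1) (x, v) := fun n x => by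
    rw [hG]
    exact (integral_indicator (hsecm x)).symm
  have hGm : ∀ n, StronglyMeasurable (G n) := fun n => by
    have : G n = fun x => ∫ v, A.indicator (fun z => w n (Φ t z).1) (x, v) := funext (hGeq n)
    rw [this]
    exact StronglyMeasurable.integral_prod_right
      (f := fun x v => A.indicator (fun z => w n (Φ t z).1) (x, v))
      (((h.measurable_comp_fst ht (hwm n)).indicator hAm).stronglyMeasurable)
  have hboundsq : Integrable (Q.indicator fun _ => ((volume Q).toReal + C * R) ^ 2) :=
    (integrable_indicator_iff hQm).2 (integrableOn_const hQfin.ne)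
  have hGsqle : ∀ n x, ‖G n x ^ 2‖ ≤ Q.indicator (fun _ => ((volume Q).toReal + C * R) ^ 2) x := by
    intro n x
    have h1 := hGbound n x
    rw [norm_pow]
    by_cases hx : x ∈ Q
    · rw [indicator_of_mem hx] at h1 ⊢
      exact pow_le_pow_left₀ (norm_nonneg _) h1 2
    · rw [indicator_of_notMem hx] at h1 ⊢
      have : ‖G n x‖ = 0 := le_antisymm h1 (norm_nonneg _)
      simp [this]
  have hGL2 : ∀ n, MemLp (G n) 2 volume := fun n =>
    (memLp_two_iff_integrable_sq (hGm n).aestronglyMeasurable).2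
      (hboundsq.mono' ((hGm n).pow 2).aestronglyMeasurable (Eventually.of_forall (hGsqle n)))
  have hGsq : Tendsto (fun n => ∫ x, G n x ^ 2) atTop (𝓝 0) := by
    have := tendsto_integral_of_dominated_convergence (μ := volume) (F := fun n x => G n x ^ 2)
      (f := fun _ => 0) _ (fun n => ((hGm n).pow 2).aestronglyMeasurable) hboundsq
      (fun n => Eventually.of_forall (hGsqle n))
      (Eventually.of_forall fun x => by simpa using (hGlim x).pow 2)
    simpa using this
  obtain ⟨D, hD⟩ := h.exists_integral_comp_fst_sq_le hA hAm
  have hfubini : ∀ n, ∫ z in A, w n z.1 * w n (Φ t z).1 = ∫ x, w n x * G n x := by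
    intro n
    have h0 := (hD 0 (by simpa using h.pos.le) (w n) (hwm n) (hw n)).1
    simp only [h.zero] at h0
    have hint : IntegrableOn (fun z => w n z.1 * w n (Φ t z).1) A :=
      h0.integrable_mul (hD t ht (w n) (hwm n) (hw n)).1
    rw [← integral_indicator hAm, Measure.volume_eq_prod, integral_prod]
    · refine integral_congr_ae (Eventually.of_forall fun x => ?_)
      simp only
      rw [hGeq, ← integral_const_mul]
      refine integral_congr_ae (Eventually.of_forall fun v => ?_)
      by_cases hz : (x, v) ∈ A <;> simp [hz]
    · exact (integrable_indicator_iff hAm).2 hint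
  simp only [hfubini]
  rw [Metric.tendsto_atTop]
  intro ε hε
  set l : ℝ := ε / (2 * (R + 1)) with hl
  have hlpos : 0 < l := by positivity
  have hev := hGsq.eventually_lt_const (show (0 : ℝ) < l * (ε / 2) by positivity)
  obtain ⟨N, hN⟩ := eventually_atTop.1 hev
  refine ⟨N, fun n hn => ?_⟩
  rw [Real.dist_eq, sub_zero]
  have h1 := abs_integral_mul_le (hw n) (hGL2 n) hlpos
  have h2 : (∫ x, G n x ^ 2) / l < ε / 2 := by
    rw [div_lt_iff₀ hlpos]; linarith [hN n hn]
  have h3 : l * ∫ x, w n x ^ 2 ≤ ε / 2 := by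
    calc l * ∫ x, w n x ^ 2 ≤ l * (R + 1) := by gcongr; linarith [hR n]
      _ = ε / 2 := by rw [hl]; field_simp
  linarith

end IsKineticFlow

end OffDiagonal

/-! ### Averages along the flow act compactly. -/

section Averaging

open Filter
open scoped NNReal Topology

theorem MeasureTheory.MemLp.integrable_fun_mul_two {X : Type*} [MeasurableSpace X] {μ : Measure X}
    {a b : X → ℝ} (ha : MemLp a 2 μ) (hb : MemLp b 2 μ) : Integrable (fun x => a x * b x) μ :=
  ha.integrable_mul hb

variable {E : Type*}

/-- The mean of the values of `φ` at the positions reached at the times `τ k / N`, `1 ≤ k ≤ N`. -/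
noncomputable def flowAverage (Φ : ℝ → E × E → E × E) (τ : ℝ) (N : ℕ) (φ : E → ℝ) (z : E × E) : ℝ :=
  (∑ k ∈ Finset.range N, φ (Φ (τ * ((k + 1) / N)) z).1) / N

theorem flowAverage_sub (Φ : ℝ → E × E → E × E) (τ : ℝ) (N : ℕ) (φ ψ : E → ℝ) (z : E × E) :
    flowAverage Φ τ N (fun x => φ x - ψ x) z = flowAverage Φ τ N φ z - flowAverage Φ τ N ψ z := by
  simp only [flowAverage, Finset.sum_sub_distrib, sub_div]

theorem abs_flowAverage_le (Φ : ℝ → E × E → E × E) (τ : ℝ) (N : ℕ) {φ : E → ℝ}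
    (hφ : ∀ x, |φ x| ≤ 1) (z : E × E) : |flowAverage Φ τ N φ z| ≤ 1 := by
  rw [flowAverage, abs_div, Nat.abs_cast]
  refine div_le_one_of_le₀ ?_ (Nat.cast_nonneg N)
  refine (Finset.abs_sum_le_sum_abs _ _).trans ?_
  refine (Finset.sum_le_sum fun k _ => hφ _).trans (by simp)

theorem flowAverage_time_mem {τ T : ℝ} (hτ : 0 < τ) (hτT : τ ≤ T) {N k : ℕ}
    (hk : k ∈ Finset.range N) : 0 < τ * ((k + 1) / N) ∧ τ * ((k + 1) / N : ℝ) ≤ τ ∧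
      |τ * ((k + 1) / N)| ≤ T := by
  have hkN : (k + 1 : ℝ) ≤ N := by exact_mod_cast Finset.mem_range.1 hk
  have hN : (0 : ℝ) < N := lt_of_lt_of_le (by positivity) hkN
  have h1 : 0 < τ * ((k + 1) / N) := by positivity
  have h2 : τ * ((k + 1) / N : ℝ) ≤ τ := by
    refine mul_le_of_le_one_right hτ.le ?_
    rwa [div_le_one hN]
  exact ⟨h1, h2, by rw [abs_of_pos h1]; exact h2.trans hτT⟩

variable [NormedAddCommGroup E] [NormedSpace ℝ E] [FiniteDimensional ℝ E]
  [MeasureSpace E] [BorelSpace E] {F : E → E} {K : ℝ≥0} {M T : ℝ} {Φ : ℝ → E × E → E × E}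

namespace IsKineticFlow

theorem measurable_flowAverage (h : IsKineticFlow F K M T Φ) {τ : ℝ} (hτ : 0 < τ) (hτT : τ ≤ T)
    (N : ℕ) {φ : E → ℝ} (hφ : Measurable φ) : Measurable (flowAverage Φ τ N φ) :=
  (Finset.measurable_fun_sum _ fun _ hk =>
    h.measurable_comp_fst (flowAverage_time_mem hτ hτT hk).2.2 hφ).div_const _

variable [(volume : Measure E).IsAddHaarMeasure]

theorem memLp_flowAverage (h : IsKineticFlow F K M T Φ) {τ : ℝ} (hτ : 0 < τ) (hτT : τ ≤ T)
    (N : ℕ) {φ : E → ℝ} (hφ : Measurable φ) (hφ2 : MemLp φ 2 volume) {A : Set (E × E)}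
    (hA : Bornology.IsBounded A) (hAm : MeasurableSet A) :
    MemLp (flowAverage Φ τ N φ) 2 (volume.restrict A) := by
  obtain ⟨C, hC⟩ := h.exists_integral_comp_fst_sq_le hA hAm
  have : flowAverage Φ τ N φ =
      fun z => (N : ℝ)⁻¹ * ∑ k ∈ Finset.range N, φ (Φ (τ * ((k + 1) / N)) z).1 := by
    ext z; rw [flowAverage, div_eq_inv_mul]
  rw [this]
  exact (memLp_finsetSum _ fun k hk =>
    (hC _ (flowAverage_time_mem hτ hτT hk).2.2 φ hφ hφ2).1).const_mul _

/-- The averages over the flow of a weakly null sequence are small in `L²`. -/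
theorem exists_eventually_setIntegral_flowAverage_sq_le (h : IsKineticFlow F K M T Φ) {τ : ℝ}
    (hτ : 0 < τ) (hτT : τ ≤ T) {A : Set (E × E)} (hA : Bornology.IsBounded A)
    (hAm : MeasurableSet A) {w : ℕ → E → ℝ} (hwm : ∀ n, Measurable (w n))
    (hw : ∀ n, MemLp (w n) 2 volume) {R : ℝ} (hR : ∀ n, ∫ x, w n x ^ 2 ≤ R)
    (hlim : ∀ k : E → ℝ, MemLp k 2 volume → Tendsto (fun n => ∫ x, k x * w n x) atTop (𝓝 0))
    {ε : ℝ} (hε : 0 < ε) :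
    ∃ N : ℕ, 0 < N ∧ ∀ᶠ n in atTop, ∫ z in A, flowAverage Φ τ N (w n) z ^ 2 ≤ ε := by
  obtain ⟨C, hC⟩ := h.exists_integral_comp_fst_sq_le hA hAm
  have hR0 : 0 ≤ R := (integral_nonneg fun x => sq_nonneg _).trans (hR 0)
  -- Of the N² terms in the expanded square only the N diagonal ones do not tend to 0. Each is at
  -- most C R, so after division by N² they contribute at most ε / 2.
  obtain ⟨N, hN⟩ := exists_nat_gt (2 * (C * R) / ε)
  have hN0 : (0 : ℝ) < N := lt_of_le_of_lt (by positivity) hN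
  have hNnat : 0 < N := by exact_mod_cast hN0
  refine ⟨N, hNnat, ?_⟩
  set s : ℕ → ℝ := fun k => τ * ((k + 1) / N) with hs
  have hsT : ∀ k ∈ Finset.range N, |s k| ≤ T := fun k hk => (flowAverage_time_mem hτ hτT hk).2.2
  have hL2 : ∀ n, ∀ k ∈ Finset.range N, MemLp (fun z => w n (Φ (s k) z).1) 2 (volume.restrict A) :=
    fun n k hk => (hC _ (hsT k hk) (w n) (hwm n) (hw n)).1
  have hint : ∀ n, ∀ j ∈ Finset.range N, ∀ k ∈ Finset.range N,
      Integrable (fun z => w n (Φ (s j) z).1 * w n (Φ (s k) z).1) (volume.restrict A) :=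
    fun n j hj k hk => (hL2 n j hj).integrable_mul (hL2 n k hk)
  have hexpand : ∀ n, ∫ z in A, flowAverage Φ τ N (w n) z ^ 2 =
      (∑ j ∈ Finset.range N, ∑ k ∈ Finset.range N,
        ∫ z in A, w n (Φ (s j) z).1 * w n (Φ (s k) z).1) / (N : ℝ) ^ 2 := by
    intro n
    simp only [flowAverage, div_pow, integral_div]
    congr 1
    simp only [sq, Finset.sum_mul_sum]
    rw [integral_finsetSum _ fun j hj => integrable_finsetSum _ fun k hk => hint n j hj k hk]
    exact Finset.sum_congr rfl fun j hj => integral_finsetSum _ fun k hk => hint n j hj k hk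
  -- Changing variables by `Φ (-s j)` reduces the pair of times (s_j, s_k) to (0, s_k − s_j). The
  -- difference is nonzero and, both times lying in (0, τ], at most T in absolute value.
  have hoff : ∀ j ∈ Finset.range N, ∀ k ∈ Finset.range N, j ≠ k →
      Tendsto (fun n => ∫ z in A, w n (Φ (s j) z).1 * w n (Φ (s k) z).1) atTop (𝓝 0) := by
    intro j hj k hk hjk
    have hjT' : |-s j| ≤ T := by rw [abs_neg]; exact hsT j hj
    have hne : s k + -s j ≠ 0 := by
      intro h0
      have : s k = s j := by linarith
      simp only [hs] at this
      have h1 := mul_left_cancel₀ hτ.ne' this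
      have h2 := (div_left_inj' hN0.ne').1 h1
      exact hjk (by exact_mod_cast (add_right_cancel h2).symm)
    have hdiff : |s k + -s j| ≤ T := by
      have h1 := flowAverage_time_mem hτ hτT hj
      have h2 := flowAverage_time_mem hτ hτT hk
      rw [abs_le]
      constructor <;> simp only [hs] <;> linarith
    have hcont := h.continuous (h.abs_le_two_mul hjT')
    have hbdd : Bornology.IsBounded (Φ (-s j) ⁻¹' A) := by
      refine ((hA.isCompact_closure.image (h.continuous (h.abs_le_two_mul (hsT j hj)))).isBounded).subset ?_
      exact fun z hz => ⟨Φ (-s j) z, subset_closure hz, h.comp_neg_self (hsT j hj) z⟩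
    have := h.tendsto_setIntegral_mul_comp_fst hdiff hne hbdd (hcont.measurable hAm) hwm hw hR hlim
    refine this.congr fun n => ?_
    rw [← (h.measurePreserving hjT').setIntegral_preimage_emb (h.measurableEmbedding hjT')
      (fun z => w n (Φ (s j) z).1 * w n (Φ (s k) z).1) A]
    simp only [h.comp_neg_self (hsT j hj), h.comp (hsT k hk) hjT']
  have hdiag : ∀ n, ∀ j ∈ Finset.range N,
      ∫ z in A, w n (Φ (s j) z).1 * w n (Φ (s j) z).1 ≤ C * R := fun n j hj => by
    simp only [← sq]
    exact (hC _ (hsT j hj) (w n) (hwm n) (hw n)).2.trans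
      (mul_le_mul_of_nonneg_left (hR n) C.coe_nonneg)
  have hofflim : Tendsto (fun n => ∑ j ∈ Finset.range N, ∑ k ∈ Finset.range N,
      if j = k then 0 else ∫ z in A, w n (Φ (s j) z).1 * w n (Φ (s k) z).1) atTop (𝓝 0) := by
    rw [show (0 : ℝ) = ∑ j ∈ Finset.range N, ∑ k ∈ Finset.range N, 0 by simp]
    refine tendsto_finsetSum _ fun j hj => tendsto_finsetSum _ fun k hk => ?_
    by_cases hjk : j = k
    · simp [hjk]
    · simpa [hjk] using hoff j hj k hk hjk
  have hpos : 0 < (N : ℝ) ^ 2 * (ε / 2) := by positivity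
  filter_upwards [hofflim.eventually_le_const hpos] with n hn
  rw [hexpand, div_le_iff₀ (by positivity)]
  have hsplit : ∀ j ∈ Finset.range N, ∑ k ∈ Finset.range N,
      ∫ z in A, w n (Φ (s j) z).1 * w n (Φ (s k) z).1 ≤ C * R + ∑ k ∈ Finset.range N,
        if j = k then 0 else ∫ z in A, w n (Φ (s j) z).1 * w n (Φ (s k) z).1 := by
    intro j hj
    have h1 : ∀ k ∈ Finset.range N, ∫ z in A, w n (Φ (s j) z).1 * w n (Φ (s k) z).1 =
        (if j = k then ∫ z in A, w n (Φ (s j) z).1 * w n (Φ (s j) z).1 else 0) +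
          if j = k then 0 else ∫ z in A, w n (Φ (s j) z).1 * w n (Φ (s k) z).1 := by
      intro k _
      by_cases hjk : j = k
      · subst hjk; simp
      · simp [hjk]
    rw [Finset.sum_congr rfl h1, Finset.sum_add_distrib, Finset.sum_ite_eq, if_pos hj]
    linarith [hdiag n j hj]
  have hsum := Finset.sum_le_sum hsplit
  rw [Finset.sum_add_distrib, Finset.sum_const, Finset.card_range, nsmul_eq_mul] at hsum
  have h3 : N * (C * R) ≤ (N : ℝ) ^ 2 * (ε / 2) := by
    rw [div_lt_iff₀ hε] at hN
    nlinarith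
  linarith

/-- Averages along the flow of bounded functions of the position cannot resolve weakly null
sequences. -/
theorem exists_abs_integral_mul_flowAverage_lt (h : IsKineticFlow F K M T Φ) {τ : ℝ} (hτ : 0 < τ)
    (hτT : τ ≤ T) {A : Set (E × E)} (hA : Bornology.IsBounded A) (hAm : MeasurableSet A)
    {H : ℕ → E × E → ℝ} (hH : ∀ n, MemLp (H n) 2 volume) (hHA : ∀ n, ∀ z ∉ A, H n z = 0)
    {R : ℝ} (hHR : ∀ n, ∫ z, H n z ^ 2 ≤ R)
    (hHlim : ∀ k : E × E → ℝ, MemLp k 2 volume →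
      Tendsto (fun n => ∫ z, k z * H n z) atTop (𝓝 0))
    {φ : ℕ → E → ℝ} (hφm : ∀ n, Measurable (φ n)) (hφ : ∀ n, MemLp (φ n) 2 volume) {R' : ℝ}
    (hφR : ∀ n, ∫ x, φ n x ^ 2 ≤ R') {ε : ℝ} (hε : 0 < ε) :
    ∃ N : ℕ, 0 < N ∧ ∃ n, |∫ z, H n z * flowAverage Φ τ N (φ n) z| < ε := by
  obtain ⟨ψ, hψm, hψ, σ, hσ, hlim⟩ := exists_weak_limit_of_integral_sq_le hφ hφR
  set w : ℕ → E → ℝ := fun n x => φ (σ n) x - ψ x with hw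
  have hwm : ∀ n, Measurable (w n) := fun n => (hφm _).sub hψm
  have hw2 : ∀ n, MemLp (w n) 2 volume := fun n => (hφ _).sub hψ
  have hwR : ∀ n, ∫ x, w n x ^ 2 ≤ 2 * R' + 2 * ∫ x, ψ x ^ 2 := by
    intro n
    calc ∫ x, w n x ^ 2 ≤ ∫ x, (2 * φ (σ n) x ^ 2 + 2 * ψ x ^ 2) := by
          refine integral_mono (hw2 n).integrable_sq
            (((hφ _).integrable_sq.const_mul 2).add (hψ.integrable_sq.const_mul 2)) fun x => ?_
          simp only [hw]
          nlinarith [sq_nonneg (φ (σ n) x + ψ x)]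
      _ = 2 * (∫ x, φ (σ n) x ^ 2) + 2 * ∫ x, ψ x ^ 2 := by
          rw [integral_add ((hφ _).integrable_sq.const_mul 2) (hψ.integrable_sq.const_mul 2),
            integral_const_mul, integral_const_mul]
      _ ≤ _ := by linarith [hφR (σ n)]
  have hwlim : ∀ k : E → ℝ, MemLp k 2 volume →
      Tendsto (fun n => ∫ x, k x * w n x) atTop (𝓝 0) := by
    intro k hk
    have h1 := (hlim k hk).sub_const (∫ x, k x * ψ x)
    rw [sub_self] at h1
    refine h1.congr fun n => ?_
    rw [← integral_sub (hk.integrable_fun_mul_two (hφ _)) (hk.integrable_fun_mul_two hψ)]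
    simp only [hw, mul_sub]
  have hR0 : 0 ≤ R := (integral_nonneg fun x => sq_nonneg _).trans (hHR 0)
  set l : ℝ := ε / (4 * (R + 1)) with hl
  have hlpos : 0 < l := by positivity
  -- N is fixed by the oscillating part w_n alone. The average of the weak limit ψ is then one fixed
  -- L² function on `A`, against which `H` tends to 0.
  obtain ⟨N, hN, hev⟩ := h.exists_eventually_setIntegral_flowAverage_sq_le hτ hτT hA hAm hwm hw2 hwR
    hwlim (show 0 < l * (ε / 4) by positivity)
  have hψA := h.memLp_flowAverage hτ hτT N hψm hψ hA hAm
  have hψA' : MemLp (A.indicator (flowAverage Φ τ N ψ)) 2 volume :=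
    (memLp_indicator_iff_restrict hAm).2 hψA
  have hHlim' := (hHlim _ hψA').comp hσ.tendsto_atTop
  have hev2 : ∀ᶠ n in atTop,
      |∫ z, A.indicator (flowAverage Φ τ N ψ) z * H (σ n) z| < ε / 4 := by
    have := (tendsto_zero_iff_norm_tendsto_zero.1 hHlim').eventually_lt_const
      (show (0 : ℝ) < ε / 4 by positivity)
    simpa using this
  obtain ⟨n, hn1, hn2⟩ := (hev.and hev2).exists
  refine ⟨N, hN, σ n, ?_⟩
  have hrestrict : ∀ u : E × E → ℝ, ∫ z, H (σ n) z * u z = ∫ z in A, H (σ n) z * u z := fun u =>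
    (setIntegral_eq_integral_of_forall_compl_eq_zero fun z hz => by rw [hHA _ z hz, zero_mul]).symm
  have hHr : MemLp (H (σ n)) 2 (volume.restrict A) := (hH _).restrict A
  have hwA := h.memLp_flowAverage hτ hτT N (hwm n) (hw2 n) hA hAm
  have heq : ∫ z, H (σ n) z * flowAverage Φ τ N (φ (σ n)) z =
      (∫ z in A, H (σ n) z * flowAverage Φ τ N (w n) z) +
        ∫ z, A.indicator (flowAverage Φ τ N ψ) z * H (σ n) z := by
    have h1 : ∫ z, A.indicator (flowAverage Φ τ N ψ) z * H (σ n) z =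
        ∫ z in A, H (σ n) z * flowAverage Φ τ N ψ z := by
      rw [← hrestrict]
      refine integral_congr_ae (Eventually.of_forall fun z => ?_)
      by_cases hz : z ∈ A
      · simp [hz, mul_comm]
      · simp [hz, hHA _ z hz]
    rw [h1, hrestrict, ← integral_add (hHr.integrable_fun_mul_two hwA)
      (hHr.integrable_fun_mul_two hψA)]
    refine integral_congr_ae (Eventually.of_forall fun z => ?_)
    simp only [hw, flowAverage_sub]
    ring
  have h1 := abs_integral_mul_le hHr hwA hlpos
  have h2 : ∫ z in A, H (σ n) z ^ 2 ≤ R :=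
    (setIntegral_le_integral (hH _).integrable_sq (Eventually.of_forall fun z => sq_nonneg _)).trans
      (hHR _)
  have h3 : l * ∫ z in A, H (σ n) z ^ 2 ≤ ε / 4 := by
    calc l * ∫ z in A, H (σ n) z ^ 2 ≤ l * (R + 1) := by gcongr; linarith
      _ = ε / 4 := by rw [hl]; field_simp
  have h4 : (∫ z in A, flowAverage Φ τ N (w n) z ^ 2) / l ≤ ε / 4 := by
    rw [div_le_iff₀ hlpos]; linarith
  rw [heq]
  refine (abs_add_le _ _).trans_lt ?_
  linarith

/-- Testing against a bounded function of the position is, up to a small error, testing a truncation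
against an average along the flow. -/
theorem abs_integral_sub_integral_flowAverage_le (h : IsKineticFlow F K M T Φ) {τ : ℝ} (hτ : 0 < τ)
    (hτT : τ ≤ T) {N : ℕ} (hN : 0 < N) {u v : E × E → ℝ} (hu : Integrable u) (hv : Integrable v)
    {C : ℝ≥0} (hC : ∀ t, |t| ≤ T → ∫⁻ z, ‖u (Φ t z) - u z‖ₑ ≤ C * ENNReal.ofReal |t|)
    {η : ℝ} (huv : ∫ z, |u z - v z| ≤ η) {φ : E → ℝ} (hφm : Measurable φ)
    (hφ : ∀ x, |φ x| ≤ 1) :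
    |(∫ z, u z * φ z.1) - ∫ z, v z * flowAverage Φ τ N φ z| ≤ C * τ + η := by
  have hmul : ∀ {u : E × E → ℝ}, Integrable u → ∀ {ψ : E × E → ℝ}, Measurable ψ →
      (∀ z, |ψ z| ≤ 1) → Integrable fun z => u z * ψ z := fun hu ψ hψ hψ1 =>
    hu.mul_bdd (c := 1) hψ.aestronglyMeasurable (Eventually.of_forall hψ1)
  -- Measure preservation rewrites the integral with both u and φ moved along the flow; moving u
  -- back costs at most Cτ, since |φ| ≤ 1.
  have hstep : ∀ t, 0 < t → t ≤ τ → |(∫ z, u z * φ z.1) - ∫ z, u z * φ (Φ t z).1| ≤ C * τ := by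
    intro t ht0 htτ
    have htT : |t| ≤ T := by rw [abs_of_pos ht0]; exact htτ.trans hτT
    have hψm := h.measurable_comp_fst htT hφm
    have hcomp : Integrable fun z => u (Φ t z) :=
      (h.measurePreserving htT).integrable_comp_of_integrable hu
    have h1 : ∫ z, u z * φ z.1 = ∫ z, u (Φ t z) * φ (Φ t z).1 :=
      ((h.measurePreserving htT).integral_comp (h.measurableEmbedding htT)
        fun z => u z * φ z.1).symm
    rw [h1, ← integral_sub (hmul hcomp hψm fun z => hφ _) (hmul hu hψm fun z => hφ _)]
    rw [← ENNReal.ofReal_le_ofReal_iff (by positivity), ← Real.enorm_eq_ofReal_abs]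
    calc ‖∫ z, (u (Φ t z) * φ (Φ t z).1 - u z * φ (Φ t z).1)‖ₑ
        ≤ ∫⁻ z, ‖u (Φ t z) * φ (Φ t z).1 - u z * φ (Φ t z).1‖ₑ := enorm_integral_le_lintegral_enorm _
      _ ≤ ∫⁻ z, ‖u (Φ t z) - u z‖ₑ := by
          refine lintegral_mono fun z => ?_
          rw [← sub_mul, enorm_mul]
          refine mul_le_of_le_one_right' ?_
          rw [Real.enorm_eq_ofReal_abs]
          exact ENNReal.ofReal_le_one.2 (hφ _)
      _ ≤ C * ENNReal.ofReal |t| := hC t htT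
      _ ≤ ENNReal.ofReal (C * τ) := by
          rw [ENNReal.ofReal_mul C.coe_nonneg, ENNReal.ofReal_coe_nnreal, abs_of_pos ht0]
          gcongr
  have hN0 : (0 : ℝ) < N := by exact_mod_cast hN
  have hSm := h.measurable_flowAverage hτ hτT N hφm
  have hS1 := abs_flowAverage_le Φ τ N hφ
  have havg : ∫ z, u z * flowAverage Φ τ N φ z =
      (∑ k ∈ Finset.range N, ∫ z, u z * φ (Φ (τ * ((k + 1) / N)) z).1) / N := by
    rw [← integral_finsetSum _ fun k hk => hmul hu
      (h.measurable_comp_fst (flowAverage_time_mem hτ hτT hk).2.2 hφm) fun z => hφ _,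
      ← integral_div]
    refine integral_congr_ae (Eventually.of_forall fun z => ?_)
    simp only [flowAverage, ← Finset.mul_sum, mul_div_assoc]
  have hA : |(∫ z, u z * φ z.1) - ∫ z, u z * flowAverage Φ τ N φ z| ≤ C * τ := by
    have : (∫ z, u z * φ z.1) - ∫ z, u z * flowAverage Φ τ N φ z =
        (∑ k ∈ Finset.range N, ((∫ z, u z * φ z.1) -
          ∫ z, u z * φ (Φ (τ * ((k + 1) / N)) z).1)) / N := by
      rw [havg, Finset.sum_sub_distrib, Finset.sum_const, Finset.card_range, nsmul_eq_mul]
      field_simp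
    rw [this, abs_div, Nat.abs_cast, div_le_iff₀ hN0]
    refine (Finset.abs_sum_le_sum_abs _ _).trans ((Finset.sum_le_sum fun k hk =>
      hstep _ (flowAverage_time_mem hτ hτT hk).1 (flowAverage_time_mem hτ hτT hk).2.1).trans ?_)
    simp [mul_comm]
  have hB : |(∫ z, u z * flowAverage Φ τ N φ z) - ∫ z, v z * flowAverage Φ τ N φ z| ≤ η := by
    rw [← integral_sub (hmul hu hSm hS1) (hmul hv hSm hS1), ← Real.norm_eq_abs]
    refine (norm_integral_le_of_norm_le (hu.sub hv).abs (Eventually.of_forall fun z => ?_)).trans huv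
    rw [← sub_mul, norm_mul]
    exact mul_le_of_le_one_right (norm_nonneg _) (hS1 z)
  calc _ ≤ _ := abs_sub_le _ (∫ z, u z * flowAverage Φ τ N φ z) _
    _ ≤ _ := add_le_add hA hB

end IsKineticFlow

end Averaging

/-! ### Relative compactness in L¹_loc. -/

section LocalCompactness

open Filter
open scoped NNReal Topology

/-- Contrapositive: if no finite set of ε-balls covers the range, values at distance at least ε from
all earlier ones can be selected indefinitely. -/
theorem totallyBounded_range_of_exists_dist_lt {ι α : Type*} [PseudoMetricSpace α] {f : ι → α}
    (h : ∀ i : ℕ → ι, ∀ ε > 0, ∃ m n, m ≠ n ∧ dist (f (i m)) (f (i n)) < ε) :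
    TotallyBounded (range f) := by
  rw [Metric.totallyBounded_iff]
  by_contra! hcon
  obtain ⟨ε, hε, hcon⟩ := hcon
  have hstep : ∀ t : Set ι, t.Finite → ∃ i, ∀ j ∈ t, ε ≤ dist (f i) (f j) := by
    intro t ht
    obtain ⟨_, ⟨i, rfl⟩, hi⟩ := not_subset.1 (hcon (f '' t) (ht.image f))
    refine ⟨i, fun j hj => ?_⟩
    by_contra! hlt
    exact hi (mem_biUnion (mem_image_of_mem f hj) hlt)
  obtain ⟨i, hi⟩ := seq_of_forall_finite_exists hstep
  obtain ⟨m, n, hmn, hlt⟩ := h i ε hε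
  rcases lt_or_gt_of_ne hmn with hlt' | hlt'
  · have := hi n (i m) (mem_image_of_mem i hlt')
    rw [dist_comm] at this
    linarith
  · have := hi m (i n) (mem_image_of_mem i hlt')
    linarith

namespace L1loc

variable {X : Type*} [TopologicalSpace X] [MeasureSpace X]

theorem continuous_restrict (K : TopologicalSpace.Compacts X) :
    Continuous (restrict K : L1loc X → _) :=
  continuous_iff_le_induced.2 (iInf_le _ K)

theorem coeFn_restrict (K : TopologicalSpace.Compacts X) (f : L1loc X) :
    restrict K f =ᵐ[volume.restrict (K : Set X)] f.1 :=
  Integrable.coeFn_toL1 _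

theorem dist_restrict (K : TopologicalSpace.Compacts X) (f g : L1loc X) :
    dist (restrict K f) (restrict K g) = ∫ x in K, |f.1 x - g.1 x| := by
  rw [L1.dist_eq_integral_dist]
  refine integral_congr_ae ?_
  filter_upwards [coeFn_restrict K f, coeFn_restrict K g] with x h1 h2
  rw [h1, h2, Real.dist_eq]

/-- Limits in `L¹(K)` and `L¹(K')` along the same filter agree on `K ⊆ K'`. -/
theorem ae_eq_of_tendsto_restrict {K K' : TopologicalSpace.Compacts X} (hK : (K : Set X) ⊆ K')
    {l : Filter (L1loc X)} [l.NeBot] {a : X →₁[(volume : Measure X).restrict (K : Set X)] ℝ}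
    {b : X →₁[(volume : Measure X).restrict (K' : Set X)] ℝ} (ha : Tendsto (restrict K) l (𝓝 a))
    (hb : Tendsto (restrict K') l (𝓝 b)) : a =ᵐ[volume.restrict (K : Set X)] b := by
  have hle : (volume : Measure X).restrict (K : Set X) ≤ volume.restrict (K' : Set X) :=
    Measure.restrict_mono_set _ hK
  have hint : ∀ c : X →₁[(volume : Measure X).restrict (K' : Set X)] ℝ,
      Integrable c (volume.restrict (K : Set X)) := fun c =>
    (L1.integrable_coeFn c).mono_measure hle
  set r : (X →₁[(volume : Measure X).restrict (K' : Set X)] ℝ) →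
      X →₁[(volume : Measure X).restrict (K : Set X)] ℝ := fun c => (hint c).toL1 c with hr
  have hrc : Continuous r := by
    refine LipschitzWith.continuous (K := 1) fun c c' => ?_
    rw [hr, Integrable.edist_toL1_toL1, ENNReal.coe_one, one_mul]
    calc ∫⁻ x in K, edist (c x) (c' x) ≤ ∫⁻ x in K', edist (c x) (c' x) := lintegral_mono' hle le_rfl
      _ = edist ((L1.integrable_coeFn c).toL1 c) ((L1.integrable_coeFn c').toL1 c') :=
          (Integrable.edist_toL1_toL1 _ _ _ _).symm
      _ = edist c c' := by rw [Integrable.toL1_coeFn, Integrable.toL1_coeFn]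
  have hcomp : ∀ f : L1loc X, r (restrict K' f) = restrict K f := fun f => by
    refine Lp.ext ?_
    filter_upwards [(hint (restrict K' f)).coeFn_toL1, coeFn_restrict K f,
      ae_mono hle (coeFn_restrict K' f)] with x h1 h2 h3
    rw [h1, h2, h3]
  have hlim : Tendsto (restrict K) l (𝓝 (r b)) :=
    ((hrc.tendsto b).comp hb).congr hcomp
  rw [tendsto_nhds_unique ha hlim]
  exact (hint b).coeFn_toL1

variable [T2Space X] [OpensMeasurableSpace X] [WeaklyLocallyCompactSpace X] [SigmaCompactSpace X]

/-- A subset of `L¹_loc` is relatively compact if its restrictions to compact sets are totally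
bounded. -/
theorem isCompact_closure_of_totallyBounded {s : Set (L1loc X)}
    (hs : ∀ K : TopologicalSpace.Compacts X, TotallyBounded (restrict K '' s)) :
    IsCompact (closure s) := by
  rw [isCompact_iff_ultrafilter_le_nhds]
  intro U hU
  -- L¹(K) is complete, so the ultrafilter has a limit on each compact set. These local limits are
  -- then glued into a single function.
  have hlim : ∀ K : TopologicalSpace.Compacts X, ∃ a, Tendsto (restrict K) U (𝓝 a) := by
    intro K
    have hc : IsCompact (closure (restrict K '' s)) :=
      isCompact_iff_totallyBounded_isComplete.2 ⟨(hs K).closure, isClosed_closure.isComplete⟩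
    obtain ⟨a, -, ha⟩ := isCompact_iff_ultrafilter_le_nhds.1 hc (U.map (restrict K)) (by
      rw [Ultrafilter.coe_map]
      refine (map_mono hU).trans ?_
      rw [map_principal, principal_mono]
      exact image_closure_subset_closure_image (continuous_restrict K))
    exact ⟨a, ha⟩
  choose a ha using hlim
  have hcons : ∀ K K' : TopologicalSpace.Compacts X, (K : Set X) ⊆ K' →
      a K =ᵐ[volume.restrict (K : Set X)] a K' :=
    fun K K' hK => ae_eq_of_tendsto_restrict hK (ha K) (ha K')
  set e := CompactExhaustion.choice X with he
  set Kc : ℕ → TopologicalSpace.Compacts X := fun n => ⟨e n, e.isCompact n⟩ with hKc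
  -- At x the value comes from the first set of the exhaustion that contains x. Only countably many
  -- local limits are used, so their a.e. consistency suffices.
  set g : X → ℝ := fun x => a (Kc (e.find x)) x with hg
  have hem : ∀ n, MeasurableSet (e n) := fun n => (e.isCompact n).measurableSet
  have hgn : ∀ n, g =ᵐ[volume.restrict (e n)] a (Kc n) := by
    intro n
    have h1 : ∀ᵐ x : X, ∀ m, m ≤ n → x ∈ e m → a (Kc m) x = a (Kc n) x := by
      rw [ae_all_iff]
      intro m
      by_cases hmn : m ≤ n
      · have := (ae_restrict_iff' (hem m)).1 (hcons (Kc m) (Kc n) (e.subset hmn))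
        filter_upwards [this] with x hx _ hxm using hx hxm
      · exact Eventually.of_forall fun x h => absurd h hmn
    refine (ae_restrict_iff' (hem n)).2 ?_
    filter_upwards [h1] with x hx hxn
    exact hx _ (e.mem_iff_find_le.1 hxn) (e.mem_find x)
  have hgK : ∀ K : TopologicalSpace.Compacts X, g =ᵐ[volume.restrict (K : Set X)] a K := by
    intro K
    obtain ⟨n, hn⟩ := e.exists_superset_of_isCompact K.isCompact
    filter_upwards [ae_mono (Measure.restrict_mono_set _ hn) (hgn n), hcons K (Kc n) hn]
      with x h1 h2
    rw [h1, h2]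
  have hgint : ∀ K : TopologicalSpace.Compacts X, IntegrableOn g K volume := fun K =>
    (integrable_congr (hgK K)).2 (L1.integrable_coeFn (a K))
  have hgm : AEStronglyMeasurable g volume := by
    rw [← Measure.restrict_univ (μ := volume), ← e.iUnion_eq, aestronglyMeasurable_iUnion_iff]
    exact fun n => (hgint (Kc n)).aestronglyMeasurable
  have hmk : AEEqFun.mk g hgm =ᵐ[volume] g := AEEqFun.coeFn_mk g hgm
  have hloc : LocallyIntegrable (AEEqFun.mk g hgm) volume := by
    intro x
    obtain ⟨K, hK, hxK⟩ := exists_compact_mem_nhds x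
    refine ⟨K, hxK, ?_⟩
    exact (integrable_congr (ae_restrict_of_ae hmk)).2 (hgint ⟨K, hK⟩)
  obtain ⟨y, hy⟩ : ∃ y : L1loc X, y.1 = AEEqFun.mk g hgm := ⟨⟨_, hloc⟩, rfl⟩
  have hUy : ↑U ≤ 𝓝 y := by
    rw [nhds_iInf]
    refine le_iInf fun K => ?_
    rw [nhds_induced, ← tendsto_iff_comap]
    have hyK : restrict K y = a K := by
      refine Lp.ext ?_
      filter_upwards [coeFn_restrict K y, ae_restrict_of_ae hmk, hgK K] with x h1 h2 h3
      rw [h1, hy, h2, h3]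
    rw [hyK]
    exact ha K
  exact ⟨y, isClosed_closure.mem_of_tendsto hUy (le_principal_iff.1 hU), hUy⟩

end L1loc

end LocalCompactness

/-! ### Two velocity averages of a sequence that are close in L¹. -/

section ClosePairs

open Filter
open scoped NNReal Topology

theorem abs_max_neg_min_le {m : ℝ} (hm : 0 ≤ m) (a : ℝ) : |max (-m) (min m a)| ≤ m :=
  abs_le.2 ⟨le_max_left _ _, max_le (by linarith) (min_le_left _ _)⟩

theorem abs_max_neg_min_le_abs {m : ℝ} (hm : 0 ≤ m) (a : ℝ) : |max (-m) (min m a)| ≤ |a| := by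
  rcases abs_cases a with h | h <;> rcases abs_cases (max (-m) (min m a)) with h' | h' <;>
    rcases max_cases (-m) (min m a) with h'' | h'' <;> rcases min_cases m a with h3 | h3 <;> linarith

/-- Bounded functions supported in a set of finite measure are bounded in `L²`. -/
theorem memLp_two_and_integral_sq_le {X : Type*} [MeasurableSpace X] {μ : Measure X} {u : X → ℝ}
    (hu : AEStronglyMeasurable u μ) {c : ℝ} (hc : ∀ x, |u x| ≤ c) {A : Set X}
    (hA : MeasurableSet A) (hμA : μ A ≠ ⊤) (huA : ∀ x ∉ A, u x = 0) :
    MemLp u 2 μ ∧ ∫ x, u x ^ 2 ∂μ ≤ c ^ 2 * μ.real A := by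
  have hint : Integrable (A.indicator fun _ => c ^ 2) μ :=
    (integrable_indicator_iff hA).2 (integrableOn_const hμA)
  have hle : ∀ x, u x ^ 2 ≤ A.indicator (fun _ => c ^ 2) x := by
    intro x
    by_cases hx : x ∈ A
    · rw [indicator_of_mem hx]
      exact sq_le_sq' (abs_le.1 (hc x)).1 (abs_le.1 (hc x)).2
    · rw [indicator_of_notMem hx, huA x hx]; simp
  have hsq : Integrable (fun x => u x ^ 2) μ := by
    refine hint.mono' (hu.pow 2) (Eventually.of_forall fun x => ?_)
    rw [Real.norm_eq_abs, abs_of_nonneg (sq_nonneg _)]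
    exact hle x
  refine ⟨(memLp_two_iff_integrable_sq hu).2 hsq, (integral_mono hsq hint hle).trans_eq ?_⟩
  rw [integral_indicator hA, setIntegral_const, smul_eq_mul, mul_comm]

/-- The `L¹(S)` norm of an integrable function is attained by testing against a sign. -/
theorem exists_measurable_setIntegral_abs_eq {X : Type*} [MeasurableSpace X] {μ : Measure X}
    {r : X → ℝ} (hr : AEStronglyMeasurable r μ) {S : Set X} (hS : MeasurableSet S) :
    ∃ φ : X → ℝ, Measurable φ ∧ (∀ x, |φ x| ≤ 1) ∧ (∀ x ∉ S, φ x = 0) ∧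
      ∫ x in S, |r x| ∂μ = ∫ x, r x * φ x ∂μ := by
  classical
  set P : Set X := {x | 0 ≤ hr.mk r x} with hP
  have hPm : MeasurableSet P :=
    measurableSet_le measurable_const hr.stronglyMeasurable_mk.measurable
  refine ⟨S.indicator (P.piecewise (fun _ => 1) fun _ => -1),
    (Measurable.piecewise hPm measurable_const measurable_const).indicator hS, fun x => ?_,
    fun x hx => indicator_of_notMem hx _, ?_⟩
  · by_cases hx : x ∈ S <;> by_cases hxP : x ∈ P <;> simp [hx, hxP]
  · rw [← integral_indicator hS]
    refine integral_congr_ae ?_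
    filter_upwards [hr.ae_eq_mk] with x hx
    by_cases hxS : x ∈ S
    · by_cases hxP : x ∈ P
      · have : 0 ≤ r x := by rw [hx]; exact hxP
        simp [hxS, hxP, abs_of_nonneg this]
      · have : r x < 0 := by rw [hx]; exact not_le.1 hxP
        simp [hxS, hxP, abs_of_neg this]
    · simp [hxS]

variable {E : Type*} [NormedAddCommGroup E] [NormedSpace ℝ E] [FiniteDimensional ℝ E]
  [MeasureSpace E] [BorelSpace E] [(volume : Measure E).IsAddHaarMeasure]
  {F : E → E} {K : ℝ≥0} {M T : ℝ} {Φ : ℝ → E × E → E × E}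

/-- Velocity averages of an equiintegrable sequence that is equicontinuous along the flow have no
uniformly separated subsequence in `L¹(S)`. -/
theorem IsKineticFlow.exists_setIntegral_abs_sub_lt (h : IsKineticFlow F K M T Φ)
    {A : Set (E × E)} (hA : Bornology.IsBounded A) (hAm : MeasurableSet A)
    {u : ℕ → E × E → ℝ} (hu : ∀ n, Integrable (u n)) (huA : ∀ n, ∀ z ∉ A, u n z = 0)
    {C : ℝ≥0} (hC : ∀ n t, |t| ≤ T → ∫⁻ z, ‖u n (Φ t z) - u n z‖ₑ ≤ C * ENNReal.ofReal |t|)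
    (hequi : ∀ η : ℝ, 0 < η → ∃ m : ℝ, 0 ≤ m ∧
      ∀ n, ∫ z, |u n z - max (-m) (min m (u n z))| ≤ η)
    {S : Set E} (hS : MeasurableSet S) (hSv : volume S ≠ ⊤) {ε : ℝ} (hε : 0 < ε) :
    ∃ m n, m ≠ n ∧ ∫ x in S, |(∫ v, u m (x, v)) - ∫ v, u n (x, v)| < ε := by
  -- Transport and truncation each cost ε / 8 for each of the two functions, ε / 2 in all; the other
  -- ε / 2 is left for the pairing with `H`.
  obtain ⟨τ, hτ, hτT, hCτ⟩ := exists_pos_le_mul_le C h.pos (show 0 < ε / 8 by positivity)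
  obtain ⟨m, hm, huv⟩ := hequi (ε / 8) (by positivity)
  set v : ℕ → E × E → ℝ := fun n z => max (-m) (min m (u n z)) with hv
  have hvm : ∀ n, AEStronglyMeasurable (v n) := fun n =>
    (aestronglyMeasurable_const (b := -m)).sup
      ((aestronglyMeasurable_const (b := m)).inf (hu n).aestronglyMeasurable)
  have hvi : ∀ n, Integrable (v n) := fun n =>
    (hu n).mono (hvm n) (Eventually.of_forall fun z => abs_max_neg_min_le_abs hm _)
  have hvA : ∀ n, ∀ z ∉ A, v n z = 0 := fun n z hz => by simp [hv, huA n z hz, hm]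
  have hAv : (volume : Measure (E × E)) A ≠ ⊤ := hA.measure_lt_top.ne
  have hv2 := fun n => memLp_two_and_integral_sq_le (hvm n)
    (fun z => abs_max_neg_min_le hm (u n z)) hAm hAv (hvA n)
  obtain ⟨ψ, -, hψ, σ, hσ, hlim⟩ :=
    exists_weak_limit_of_integral_sq_le (fun n => (hv2 n).1) (fun n => (hv2 n).2)
  -- Consecutive differences of a weakly convergent sequence tend weakly to 0, so the limit itself
  -- plays no further role.
  set H : ℕ → E × E → ℝ := fun n z => v (σ n) z - v (σ (n + 1)) z with hH
  have hHA : ∀ n, ∀ z ∉ A, H n z = 0 := fun n z hz => by simp [hH, hvA _ z hz]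
  have hH2 := fun n => memLp_two_and_integral_sq_le (μ := volume) (u := H n) (c := m + m)
    ((hvm (σ n)).sub (hvm (σ (n + 1))))
    (fun z => (abs_sub _ _).trans (add_le_add (abs_max_neg_min_le hm _) (abs_max_neg_min_le hm _)))
    hAm hAv (hHA n)
  have hHlim : ∀ k : E × E → ℝ, MemLp k 2 volume →
      Tendsto (fun n => ∫ z, k z * H n z) atTop (𝓝 0) := by
    intro k hk
    have h1 := (hlim k hk).sub ((hlim k hk).comp (tendsto_add_atTop_nat 1))
    rw [sub_self] at h1
    refine h1.congr fun n => ?_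
    simp only [Function.comp_apply, hH, mul_sub]
    rw [integral_sub (hk.integrable_fun_mul_two (hv2 _).1) (hk.integrable_fun_mul_two (hv2 _).1)]
  have hr : ∀ n, AEStronglyMeasurable
      (fun x => (∫ w, u (σ n) (x, w)) - ∫ w, u (σ (n + 1)) (x, w)) (volume : Measure E) := fun n =>
    (hu _).aestronglyMeasurable.integral_prod_right'.sub
      (hu _).aestronglyMeasurable.integral_prod_right'
  -- The signs φ_n vary with n without any strong compactness. They are bounded in L² because `S`
  -- has finite measure, which is all that averaging along the flow needs.
  choose φ hφm hφ1 hφS hφeq using fun n => exists_measurable_setIntegral_abs_eq (hr n) hS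
  have hφ2 := fun n => memLp_two_and_integral_sq_le (μ := volume)
    (hφm n).aestronglyMeasurable (hφ1 n) hS hSv (hφS n)
  obtain ⟨N, hN, n, hn⟩ := h.exists_abs_integral_mul_flowAverage_lt hτ hτT hA hAm
    (fun n => (hH2 n).1) hHA (fun n => (hH2 n).2) hHlim hφm (fun n => (hφ2 n).1)
    (fun n => (hφ2 n).2) (show 0 < ε / 2 by positivity)
  refine ⟨σ n, σ (n + 1), (hσ n.lt_succ_self).ne, ?_⟩
  have hfst : Measurable fun z : E × E => φ n z.1 := (hφm n).comp measurable_fst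
  have hmul : ∀ k, Integrable fun z : E × E => u k z * φ n z.1 := fun k =>
    (hu k).mul_bdd (c := 1) hfst.aestronglyMeasurable (Eventually.of_forall fun z => hφ1 n z.1)
  have hfub : ∀ k, ∫ z, u k z * φ n z.1 = ∫ x, (∫ w, u k (x, w)) * φ n x := fun k => by
    rw [Measure.volume_eq_prod, integral_prod _ (hmul k)]
    simp only [integral_mul_const]
  have hmulx : ∀ k, Integrable fun x : E => (∫ w, u k (x, w)) * φ n x := fun k =>
    (hu k).integral_prod_left.mul_bdd (c := 1) (hφm n).aestronglyMeasurable
      (Eventually.of_forall (hφ1 n))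
  have heq : ∫ x in S, |(∫ w, u (σ n) (x, w)) - ∫ w, u (σ (n + 1)) (x, w)| =
      (∫ z, u (σ n) z * φ n z.1) - ∫ z, u (σ (n + 1)) z * φ n z.1 := by
    rw [hφeq n, hfub, hfub, ← integral_sub (hmulx _) (hmulx _)]
    simp only [sub_mul]
  have hSm := h.measurable_flowAverage hτ hτT N (hφm n)
  have hvS : ∀ k, Integrable fun z => v k z * flowAverage Φ τ N (φ n) z := fun k =>
    (hvi k).mul_bdd (c := 1) hSm.aestronglyMeasurable
      (Eventually.of_forall (abs_flowAverage_le Φ τ N (hφ1 n)))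
  have hHeq : ∫ z, H n z * flowAverage Φ τ N (φ n) z =
      (∫ z, v (σ n) z * flowAverage Φ τ N (φ n) z) -
        ∫ z, v (σ (n + 1)) z * flowAverage Φ τ N (φ n) z := by
    rw [← integral_sub (hvS _) (hvS _)]
    simp only [hH, sub_mul]
  have hb := fun k => abs_le.1 (h.abs_integral_sub_integral_flowAverage_le hτ hτT hN (hu k) (hvi k)
    (hC k) (huv k) (hφm n) (hφ1 n))
  rw [hHeq] at hn
  rw [heq]
  linarith [(hb (σ n)).2, (hb (σ (n + 1))).1, (abs_lt.1 hn).2]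

end ClosePairs

/-! ### Truncation of equiintegrable families and compactness of velocity averages. -/

section VelocityAverages

open Filter
open scoped NNReal Topology

variable {d : ℕ} {ι : Type*}
  {f g : ι → EuclideanSpace ℝ (Fin d) × EuclideanSpace ℝ (Fin d) → ℝ}
  {F : EuclideanSpace ℝ (Fin d) → EuclideanSpace ℝ (Fin d)} {K : ℝ≥0} {M T : ℝ}
  {Φ : ℝ → EuclideanSpace ℝ (Fin d) × EuclideanSpace ℝ (Fin d) →
    EuclideanSpace ℝ (Fin d) × EuclideanSpace ℝ (Fin d)}

theorem abs_sub_max_neg_min_le_abs {m : ℝ} (hm : 0 ≤ m) (a : ℝ) :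
    |a - max (-m) (min m a)| ≤ |a| := by
  rcases abs_cases a with h | h <;> rcases abs_cases (a - max (-m) (min m a)) with h' | h' <;>
    rcases max_cases (-m) (min m a) with h'' | h'' <;> rcases min_cases m a with h3 | h3 <;> linarith

/-- After localization, a locally equiintegrable family is uniformly approximated in `L¹` by its
truncations. -/
theorem LocEquiintegrableXV.exists_integral_abs_sub_le (hXV : LocEquiintegrableXV f)
    (hf : BoundedInL1loc f) {χ : EuclideanSpace ℝ (Fin d) × EuclideanSpace ℝ (Fin d) → ℝ}
    (hχ : Continuous χ) (hχc : HasCompactSupport χ) {η : ℝ} (hη : 0 < η) :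
    ∃ m : ℝ, 0 ≤ m ∧
      ∀ i, ∫ z, |χ z * f i z - max (-m) (min m (χ z * f i z))| ≤ η := by
  set S := tsupport χ with hS
  have hSm : MeasurableSet S := (isClosed_tsupport χ).measurableSet
  obtain ⟨c₀, hc₀⟩ := hχc.exists_bound_of_continuous hχ
  obtain ⟨c, hc, hχle⟩ : ∃ c : ℝ, 0 < c ∧ ∀ z, ‖χ z‖ ≤ c :=
    ⟨max c₀ 1, by positivity, fun z => (hc₀ z).trans (le_max_left _ _)⟩
  obtain ⟨Cf, hCf⟩ := hf.exists_setLIntegral_le (K := S) hχc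
  obtain ⟨α, hα, hXVα⟩ := hXV (η / c) (by positivity) S hχc
  -- Chebyshev's inequality bounds the volume of {|u| ≥ m} by c Cf / m. The added 1 keeps m positive
  -- and makes this strictly less than α.
  set m : ℝ := (c * Cf + 1) / α with hm
  have hm0 : 0 < m := by positivity
  refine ⟨m, hm0.le, fun i => ?_⟩
  set u : EuclideanSpace ℝ (Fin d) × EuclideanSpace ℝ (Fin d) → ℝ := fun z => χ z * f i z with hu
  have hum : AEStronglyMeasurable u :=
    hχ.aestronglyMeasurable.mul (hf.1 i).aestronglyMeasurable
  have hule : ∀ z, ‖u z‖ₑ ≤ ENNReal.ofReal c * S.indicator (fun z => ‖f i z‖ₑ) z := by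
    intro z
    by_cases hz : z ∈ S
    · rw [indicator_of_mem hz, hu, enorm_mul, ← ofReal_norm (χ z)]
      gcongr
      exact hχle z
    · simp [hu, image_eq_zero_of_notMem_tsupport hz]
  -- `u` is only a.e. strongly measurable, while equiintegrability is stated for measurable sets;
  -- the measurable hull has the same volume.
  set B := toMeasurable volume {z | ENNReal.ofReal m ≤ ‖u z‖ₑ} with hB
  have hBv : volume B < ENNReal.ofReal α := by
    calc volume B ≤ (∫⁻ z, ‖u z‖ₑ) / ENNReal.ofReal m := by
          rw [hB, measure_toMeasurable]
          exact meas_ge_le_lintegral_div hum.enorm (by simpa using hm0) ENNReal.ofReal_ne_top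
      _ ≤ (ENNReal.ofReal c * Cf) / ENNReal.ofReal m := by
          gcongr
          refine (lintegral_mono hule).trans ?_
          rw [lintegral_const_mul' _ _ ENNReal.ofReal_ne_top, lintegral_indicator hSm]
          gcongr
          exact hCf i
      _ = ENNReal.ofReal (c * Cf / m) := by
          rw [ENNReal.ofReal_div_of_pos hm0, ENNReal.ofReal_mul hc.le, ENNReal.ofReal_coe_nnreal]
      _ < ENNReal.ofReal α := by
          rw [ENNReal.ofReal_lt_ofReal_iff hα, div_lt_iff₀ hm0, hm]
          field_simp
          linarith
  have hpt : ∀ z, ‖|u z - max (-m) (min m (u z))|‖ₑ ≤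
      B.indicator (fun z => ENNReal.ofReal c * S.indicator (fun z => ‖f i z‖ₑ) z) z := by
    intro z
    rw [Real.enorm_abs]
    by_cases hz : z ∈ B
    · rw [indicator_of_mem hz]
      exact (enorm_le_iff_norm_le.2 (abs_sub_max_neg_min_le_abs hm0.le (u z))).trans (hule z)
    · have hlt : ¬ ENNReal.ofReal m ≤ ‖u z‖ₑ := fun hle => hz (subset_toMeasurable _ _ hle)
      rw [not_le, Real.enorm_eq_ofReal_abs, ENNReal.ofReal_lt_ofReal_iff hm0, abs_lt] at hlt
      rw [min_eq_right hlt.2.le, max_eq_right hlt.1.le]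
      simp
  rw [← ENNReal.ofReal_le_ofReal_iff hη.le]
  calc ENNReal.ofReal (∫ z, |u z - max (-m) (min m (u z))|)
      ≤ ‖∫ z, |u z - max (-m) (min m (u z))|‖ₑ := by
        rw [Real.enorm_eq_ofReal_abs]; exact ENNReal.ofReal_le_ofReal (le_abs_self _)
    _ ≤ ∫⁻ z, ‖|u z - max (-m) (min m (u z))|‖ₑ := enorm_integral_le_lintegral_enorm _
    _ ≤ ENNReal.ofReal c * ∫⁻ z in B, S.indicator (fun z => ‖f i z‖ₑ) z := by
        rw [← lintegral_const_mul' _ _ ENNReal.ofReal_ne_top,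
          ← lintegral_indicator (measurableSet_toMeasurable _ _)]
        exact lintegral_mono hpt
    _ ≤ ENNReal.ofReal c * ENNReal.ofReal (η / c) := by
        gcongr
        exact hXVα B (measurableSet_toMeasurable _ _) hBv i
    _ = ENNReal.ofReal η := by
        rw [← ENNReal.ofReal_mul hc.le, mul_div_cancel₀ _ hc.ne']

/-- Velocity averages of a locally equiintegrable family with bounded transport derivatives are
relatively compact in `L¹_loc`. -/
theorem IsKineticFlow.exists_isCompact_closure_range (h : IsKineticFlow F K M T Φ)
    (hf : BoundedInL1loc f) (hXV : LocEquiintegrableXV f)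
    (hfg : ∀ i, IsTransportDeriv F (f i) (g i)) (hg : BoundedInL1loc g)
    {Ψ : EuclideanSpace ℝ (Fin d) → ℝ} (hΨ : ContDiff ℝ 1 Ψ) (hΨc : HasCompactSupport Ψ) :
    ∃ ρ : ι → L1loc (EuclideanSpace ℝ (Fin d)),
      (∀ i, (ρ i).1 =ᵐ[volume] fun x => ∫ v, f i (x, v) * Ψ v) ∧
      IsCompact (closure (range ρ)) := by
  -- The cutoff θ(x)Ψ(v) serves both as localization and as weight: over `S` the weighted average of
  -- f is the plain v-integral of χ f.
  have hcut : ∀ S : Set (EuclideanSpace ℝ (Fin d)), IsCompact S →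
      ∃ χ : EuclideanSpace ℝ (Fin d) × EuclideanSpace ℝ (Fin d) → ℝ, ContDiff ℝ 1 χ ∧
        HasCompactSupport χ ∧ ∀ x ∈ S, ∀ v, χ (x, v) = Ψ v := by
    intro S hS
    obtain ⟨θ, hθ, -, hθc, hθ1⟩ := hS.exists_contDiff_eq_one
    refine ⟨fun z => θ z.1 * Ψ z.2, (hθ.comp contDiff_fst).mul (hΨ.comp contDiff_snd), ?_,
      fun x hx v => by simp [hθ1 x hx]⟩
    refine HasCompactSupport.intro (IsCompact.prod hθc hΨc) fun z hz => ?_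
    rw [mem_prod, not_and_or] at hz
    rcases hz with hz | hz
    · simp [image_eq_zero_of_notMem_tsupport hz]
    · simp [image_eq_zero_of_notMem_tsupport hz]
  have hint : ∀ χ : EuclideanSpace ℝ (Fin d) × EuclideanSpace ℝ (Fin d) → ℝ, ContDiff ℝ 1 χ →
      HasCompactSupport χ → ∀ i, Integrable fun z => χ z * f i z := fun χ hχ hχc i =>
    (hf.1 i).integrable_smul_left_of_hasCompactSupport hχ.continuous hχc
  set G : ι → EuclideanSpace ℝ (Fin d) → ℝ := fun i x => ∫ v, f i (x, v) * Ψ v with hG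
  have hGχ : ∀ {S : Set (EuclideanSpace ℝ (Fin d))}
      {χ : EuclideanSpace ℝ (Fin d) × EuclideanSpace ℝ (Fin d) → ℝ},
      (∀ x ∈ S, ∀ v, χ (x, v) = Ψ v) → ∀ i, ∀ x ∈ S,
        G i x = ∫ v, χ (x, v) * f i (x, v) := by
    intro S χ hχ i x hx
    simp only [hG, hχ x hx, mul_comm]
  have hGloc : ∀ i, LocallyIntegrable (G i) volume := by
    intro i
    rw [locallyIntegrable_iff]
    intro S hS
    obtain ⟨χ, hχ, hχc, hχΨ⟩ := hcut S hS
    have h1 : Integrable fun x => ∫ v, χ (x, v) * f i (x, v) :=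
      (hint χ hχ hχc i).integral_prod_left
    exact h1.integrableOn.congr_fun (fun x hx => (hGχ hχΨ i x hx).symm) hS.measurableSet
  have hGm : ∀ i, AEStronglyMeasurable (G i) volume := fun i => (hGloc i).aestronglyMeasurable
  have hmk : ∀ i, AEEqFun.mk (G i) (hGm i) =ᵐ[volume] G i := fun i => AEEqFun.coeFn_mk _ _
  let ρ : ι → L1loc (EuclideanSpace ℝ (Fin d)) := fun i =>
    ⟨AEEqFun.mk (G i) (hGm i), (locallyIntegrable_congr (hmk i)).2 (hGloc i)⟩
  have hρ : ∀ i, (ρ i).1 =ᵐ[volume] G i := hmk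
  refine ⟨ρ, hρ, L1loc.isCompact_closure_of_totallyBounded fun S => ?_⟩
  rw [← range_comp]
  refine totallyBounded_range_of_exists_dist_lt fun i ε hε => ?_
  obtain ⟨χ, hχ, hχc, hχΨ⟩ := hcut S S.isCompact
  obtain ⟨C, hC⟩ := h.exists_lintegral_mul_comp_sub_le hf hg hfg hχ hχc
  obtain ⟨m, n, hmn, hlt⟩ := h.exists_setIntegral_abs_sub_lt (A := tsupport χ)
    (u := fun n z => χ z * f (i n) z) (IsCompact.isBounded hχc)
    (isClosed_tsupport χ).measurableSet (fun n => hint χ hχ hχc (i n))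
    (fun n z hz => by simp [image_eq_zero_of_notMem_tsupport hz]) (fun n t ht => hC (i n) t ht)
    (fun η hη => by
      obtain ⟨m, hm, hle⟩ := hXV.exists_integral_abs_sub_le hf hχ.continuous hχc hη
      exact ⟨m, hm, fun n => hle (i n)⟩)
    S.isCompact.measurableSet S.isCompact.measure_lt_top.ne hε
  refine ⟨m, n, hmn, lt_of_eq_of_lt ?_ hlt⟩
  rw [Function.comp_apply, Function.comp_apply, L1loc.dist_restrict]
  refine integral_congr_ae ?_
  filter_upwards [ae_restrict_mem S.isCompact.measurableSet, ae_restrict_of_ae (hρ (i m)),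
    ae_restrict_of_ae (hρ (i n))] with x hx h1 h2
  rw [h1, h2, hGχ hχΨ _ x hx, hGχ hχΨ _ x hx]

end VelocityAverages

theorem theorem1 {d : ℕ} (hd : 1 ≤ d)
    (F : EuclideanSpace ℝ (Fin d) → EuclideanSpace ℝ (Fin d)) (hF : MemW1Infty F)
    {ι : Type*} (f g : ι → EuclideanSpace ℝ (Fin d) × EuclideanSpace ℝ (Fin d) → ℝ)
    (hf : BoundedInL1loc f) (hfv : LocEquiintegrableV f)
    (hfg : ∀ i, IsTransportDeriv F (f i) (g i)) (hg : BoundedInL1loc g) :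
    LocEquiintegrableXV f ∧
    ∀ Ψ : EuclideanSpace ℝ (Fin d) → ℝ, ContDiff ℝ 1 Ψ → HasCompactSupport Ψ →
      ∃ ρ : ι → L1loc (EuclideanSpace ℝ (Fin d)),
        (∀ i, (ρ i).1 =ᵐ[volume] fun x => ∫ v, f i (x, v) * Ψ v) ∧
        IsCompact (closure (range ρ)) := by
  obtain ⟨F', K, M, hK, hM, hFF'⟩ := hF.exists_lipschitz
  obtain ⟨K', T, Φ, h⟩ := exists_isKineticFlow hK hM
  have hfg' : ∀ i, IsTransportDeriv F' (f i) (g i) := fun i => (hfg i).congr_field hFF'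
  have hXV := h.locEquiintegrableXV hf hfv hfg' hg
  exact ⟨hXV, fun Ψ hΨ hΨc => h.exists_isCompact_closure_range hf hXV hfg' hg hΨ hΨc⟩
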